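/- **Setting.** Let $\mathbb X\subset\mathbb R$ be an interval (finite or infinite; possibly $\mathbb R$). A *lattice* $\mathcal L=\bigcup_{k\in\mathbb Z}\mathcal L_k$ on $\mathbb X$ consists of generations $\mathcal L_k$, each a partition of $\mathbb X$ into bounded intervals $[a,b)$, $a<b$, such that every $I\in\mathcal L_k$ is a finite union of intervals of $\mathcal L_{k+1}$ (possibly $I\in\mathcal L_{k+1}$). The rank of $I\in\mathcal L$ is the largest $k$ with $I\in\mathcal L_k$ (if it exists), and the children of $I$ are then the $J\in\mathcal L_{k+1}$ with $J\subset I$. Put $\mathbb E_If=\bigl(|I|^{-1}\int_If\bigr)\mathbf 1_I$, $\mathbb E_kf=\sum_{I\in\mathcal L_k}\mathbb E_If$, $\Delta_kf=\mathbb E_kf-\mathbb E_{k-1}f$, and $\Delta_If=\sum_{J\in\mathrm{child}(I)}\mathbb E_Jf-\mathbb E_If$ ($\Delta_If=0$ if $I$ has no rank). Let $\mathfrak A$ be the collection of the intervals of finite length of the form $\bigcup_{k\in\mathbb Z}I_k$ with $I_k\in\mathcal L_k$, $I_k\subset I_{k-1}$, and let $\Delta_{-\infty}f=\sum_{I\in\mathfrak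 A}\mathbb E_If$. All functions are real or complex valued functions on $\mathbb X$, measurable with respect to the $\sigma$-algebra generated by $\mathcal L$; "locally integrable" means locally integrable on $\mathbb X$ and integrable on every $I\in\mathcal L$. Put $$\widetilde Sf=\Bigl(\sum_{k\in\mathbb Z}|\Delta_kf|^2+|\Delta_{-\infty}f|^2\Bigr)^{1/2},\qquad Sf=\Bigl(\sum_{I\in\mathcal L}|\Delta_If|^2\Bigr)^{1/2},\qquad S_p^{\mathrm{av}}f=\Bigl(\sum_{I\in\mathcal L}\bigl(\mathbb E_I|\Delta_If|^p\bigr)^{2/p}\Bigr)^{1/2}.$$ For $1\le p<\infty$, the Hardy space $H^p=H^p(\mathcal L)$ is the set of locally integrable $f$ (with $f\in L^1(\mathbb X)$ if $p=1$) such that $\widetilde Sf\in L^p(\mathbb X)$ and $\mathbb E_If=0$ (that is, $f$ is integrable on $I$ with integral $0$) for all $I\in\mathfrak A$. All norms $\|\cdot\|_p$ are those of $L^p(\mathbb X)$, with values in $[0,\infty]$. **Theorem.** 1. For every $p\in[1,2]$ there is $C_p<\infty$ such that for every lattice $\mathcal L$ and every $f\in H^p(\mathcal L)$, $$\|S_p^{\mathrm{av}}f\|_p\le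 C_p\,\|Sf\|_p.$$ 2. For every $p\in[2,\infty)$ there is $C_p<\infty$ such that for every lattice $\mathcal L$ and every $f\in H^p(\mathcal L)$, $$\|Sf\|_p\le C_p\,\|S_p^{\mathrm{av}}f\|_p.$$ 3. The inequality in 1 fails for $p>2$: for every $p\in(2,\infty)$ there are a lattice $\mathcal L$ and a function $f\in H^p(\mathcal L)\cap L^p(\mathbb X)$ such that $\|Sf\|_p<\infty$ but $\|S_p^{\mathrm{av}}f\|_p=\infty$. 4. The inequality in 2 fails for $p<2$: for every $p\in[1,2)$ there is a lattice $\mathcal L$ such that (a) there is a locally integrable function $f$ with $\mathbb E_If=0$ for all $I\in\mathfrak A$, for which $\|S_p^{\mathrm{av}}f\|_p<\infty$ but $\|Sf\|_p=\infty$; and (b) for every $C<\infty$ there is $f\in H^p(\mathcal L)$ with $\|Sf\|_p>C\,\|S_p^{\mathrm{av}}f\|_p$. -/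

import Mathlib

open MeasureTheory Set
open scoped ENNReal NNReal

noncomputable section

/-- A lattice of intervals on an interval `X` of the real line: a sequence of generations
`gen k`, `k ∈ ℤ`, each of which is a partition of `X` into bounded non-trivial intervals `[a, b)`,
such that every interval of `gen k` is a finite union of intervals of `gen (k + 1)`. -/
structure IntervalLattice where
  X : Set ℝ
  ordConnected : X.OrdConnected
  gen : ℤ → Set (Set ℝ)
  isIco : ∀ k, ∀ I ∈ gen k, ∃ a b : ℝ, a < b ∧ I = Ico a b
  disjoint : ∀ k, (gen k).PairwiseDisjoint id
  cover : ∀ k, ⋃₀ gen k = X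
  refinement : ∀ k, ∀ I ∈ gen k,
    {J | J ∈ gen (k + 1) ∧ J ⊆ I}.Finite ∧ ⋃₀ {J | J ∈ gen (k + 1) ∧ J ⊆ I} = I

/-- The averaging operator `E_I f = ⟨f⟩_I 1_I`. -/
def intervalAvg {E : Type*} [NormedAddCommGroup E] [NormedSpace ℝ E]
    (I : Set ℝ) (f : ℝ → E) : ℝ → E :=
  I.indicator fun _ => ⨍ y in I, f y

namespace IntervalLattice

variable (L : IntervalLattice) {𝕜 : Type*} [RCLike 𝕜]

/-- The collection of all intervals of the lattice. -/
def intervals : Set (Set ℝ) := ⋃ k, L.gen k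

/-- `k` is the rank of `I`: the largest `k` such that `I` belongs to the generation `k`. An interval
that stays in all late generations has no rank. -/
def IsRank (I : Set ℝ) (k : ℤ) : Prop := IsGreatest {j | I ∈ L.gen j} k

/-- The children of `I`. -/
def children (I : Set ℝ) : Set (Set ℝ) :=
  {J | ∃ k, L.IsRank I k ∧ J ∈ L.gen (k + 1) ∧ J ⊆ I}

open Classical in
/-- The martingale difference `Δ_I f = ∑_{J ∈ child I} E_J f - E_I f`
(zero if `I` is never subdivided). -/
def diff (I : Set ℝ) (f : ℝ → 𝕜) : ℝ → 𝕜 := fun x =>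
  if ∃ k, L.IsRank I k then (∑ᶠ J ∈ L.children I, intervalAvg J f x) - intervalAvg I f x else 0

/-- The conditional expectation `E_k f = ∑_{I ∈ gen k} E_I f`. -/
def condExp (k : ℤ) (f : ℝ → 𝕜) : ℝ → 𝕜 := fun x => ∑ᶠ I ∈ L.gen k, intervalAvg I f x

/-- `Δ_k f = E_k f - E_{k-1} f`. -/
def genDiff (k : ℤ) (f : ℝ → 𝕜) : ℝ → 𝕜 := fun x => L.condExp k f x - L.condExp (k - 1) f x

/-- The maximal intervals `⋃_k I_k`, where `I_k ∈ gen k` and `I_k ⊆ I_{k-1}` for all `k ∈ ℤ`. -/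
def topIntervals : Set (Set ℝ) :=
  {I | ∃ c : ℤ → Set ℝ, (∀ k, c k ∈ L.gen k) ∧ (∀ k, c k ⊆ c (k - 1)) ∧ I = ⋃ k, c k}

/-- The maximal intervals of finite length. -/
def topIntervalsFin : Set (Set ℝ) := {I | I ∈ L.topIntervals ∧ volume I < ∞}

/-- `Δ_{-∞} f`, the sum of `E_I f` over all maximal intervals `I` of finite length. -/
def topDiff (f : ℝ → 𝕜) : ℝ → 𝕜 := fun x => ∑ᶠ I ∈ L.topIntervalsFin, intervalAvg I f x

/-- The σ-algebra generated by all intervals of the lattice. -/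
abbrev sigmaAlgebra : MeasurableSpace ℝ := MeasurableSpace.generateFrom L.intervals

/-- The `L^p(X)` norm, with values in `[0, ∞]`, of a `[0, ∞]`-valued function. -/
def lpNorm (p : ℝ) (g : ℝ → ℝ≥0∞) : ℝ≥0∞ :=
  eLpNorm g (ENNReal.ofReal p) (volume.restrict L.X)

/-- The extended square function `(∑_{k ∈ ℤ ∪ {-∞}} |Δ_k f|²)^{1/2}`. -/
def extSquareFunction (f : ℝ → 𝕜) : ℝ → ℝ≥0∞ := fun x =>
  ((∑' k : ℤ, ‖L.genDiff k f x‖ₑ ^ (2 : ℝ)) + ‖L.topDiff f x‖ₑ ^ (2 : ℝ)) ^ (1 / 2 : ℝ)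

/-- The square function `(∑_{I ∈ L} |Δ_I f|²)^{1/2}`. -/
def squareFunction (f : ℝ → 𝕜) : ℝ → ℝ≥0∞ := fun x =>
  (∑' I : L.intervals, ‖L.diff I f x‖ₑ ^ (2 : ℝ)) ^ (1 / 2 : ℝ)

/-- The averaged square function `(∑_{I ∈ L} (E_I |Δ_I f|^p)^{2/p})^{1/2}`. -/
def avgSquareFunction (p : ℝ) (f : ℝ → 𝕜) : ℝ → ℝ≥0∞ := fun x =>
  (∑' I : L.intervals,
    ‖intervalAvg (I : Set ℝ) (fun y => ‖L.diff I f y‖ ^ p) x‖ₑ ^ (2 / p)) ^ (1 / 2 : ℝ)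

/-- `f` is a function on `X`, measurable with respect to the σ-algebra of the lattice, locally
integrable, and integrable on the intervals of the lattice, so that all its averages are defined.
(The values of `f` outside `X` play no role.) -/
structure Admissible (f : ℝ → 𝕜) : Prop where
  measurable : Measurable[L.sigmaAlgebra] (L.X.indicator f)
  locallyIntegrable : LocallyIntegrableOn f L.X
  integrableOn : ∀ I ∈ L.intervals, IntegrableOn f I

/-- `E_I f = 0` for all maximal intervals `I` of finite length. -/
def TopMeanZero (f : ℝ → 𝕜) : Prop :=
  ∀ I ∈ L.topIntervalsFin, IntegrableOn f I ∧ ∫ y in I, f y = 0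

/-- The martingale Hardy space `H^p`, `1 ≤ p < ∞`. -/
structure MemHardy (p : ℝ) (f : ℝ → 𝕜) : Prop where
  admissible : L.Admissible f
  integrable : p = 1 → IntegrableOn f L.X
  extSquareFunction_lt_top : L.lpNorm p (L.extSquareFunction f) < ∞
  topMeanZero : L.TopMeanZero f

end IntervalLattice

end

/-! At almost no cost the positive parts become statements about nonnegative functions. Put
$h_k=|\Delta_{k+1}f|^p$, which is constant on the intervals of generation $k+1$, and $e_k=\mathbb
E_kh_k$. An interval of rank $k$ contributes $\Delta_{k+1}f$, so on $\mathbb X$ one has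
$(Sf)^p=(\sum h_k^{2/p})^{p/2}$ and $(S_p^{\mathrm{av}}f)^p=(\sum e_k^{2/p})^{p/2}$.

For $p\le2$, with $r=2/p\ge1$, the claim is Lépingle's inequality $\int(\sum
e_k^r)^{1/r}\le2\int(\sum h_k^r)^{1/r}$ (`lintegral_sum_cellAvg_le`). The increment
$(a^r+b^r)^{1/r}-a$ of an $\ell^r$ norm is convex in $b$ and decreasing in $a$. Jensen on each
interval therefore replaces the averages by the functions themselves, and the increments telescope.

For $p\ge2$, with $q=p/2\ge1$, the claim is $\int(\sum h_k^{1/q})^q\le C\int(\sum e_k^{1/q})^q$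
(`lintegral_sum_rpow_le_cellAvg`). Expand the $q$-th power of the partial sums one term at a time,
apply Jensen to the concave function $t^{1/q}$, and absorb half of the left side, which is finite
because $f\in H^p$.

The counterexamples live on one lattice. In each $[j,j+1)$ a core shrinks towards the middle half,
losing a short piece at each end in every generation. A function equal to $c$ and $-c$ on the two
pieces has martingale differences with disjoint supports, so $Sf=|f|$, whereas the averages of all
the differences pile up on the middle half. With $2^j$ differences of equal $p$-th moment $w_j$ in
$[j,j+1)$, $\|Sf\|_p^p=\sum2^jw_j$ and $\|S_p^{\mathrm{av}}f\|_p^p$ is comparable to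
$\sum2^{jp/2}w_j$. The exponent $p=2$ separates the two behaviours. -/

namespace IntervalLattice

variable (L : IntervalLattice) {k m : ℤ} {I J : Set ℝ} {x y : ℝ}

/-! ### The intervals of a generation -/

section Basic

variable {L}

theorem nonempty_of_mem_gen (hI : I ∈ L.gen k) : I.Nonempty := by
  obtain ⟨a, b, hab, rfl⟩ := L.isIco k I hI
  exact nonempty_Ico.2 hab

theorem measurableSet_of_mem_gen (hI : I ∈ L.gen k) : MeasurableSet I := by
  obtain ⟨a, b, hab, rfl⟩ := L.isIco k I hI
  exact measurableSet_Ico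

theorem volume_ne_zero_of_mem_gen (hI : I ∈ L.gen k) : volume I ≠ 0 := by
  obtain ⟨a, b, hab, rfl⟩ := L.isIco k I hI
  simpa using hab

theorem volume_ne_top_of_mem_gen (hI : I ∈ L.gen k) : volume I ≠ ∞ := by
  obtain ⟨a, b, hab, rfl⟩ := L.isIco k I hI
  simp

theorem subset_X_of_mem_gen (hI : I ∈ L.gen k) : I ⊆ L.X := by
  rw [← L.cover k]
  exact subset_sUnion_of_mem hI

theorem mem_intervals_of_mem_gen (hI : I ∈ L.gen k) : I ∈ L.intervals :=
  mem_iUnion.2 ⟨k, hI⟩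

theorem eq_of_mem_gen (hI : I ∈ L.gen k) (hJ : J ∈ L.gen k) (hx : x ∈ I) (hy : x ∈ J) : I = J :=
  (L.disjoint k).elim_set hI hJ x hx hy

theorem countable_gen (k : ℤ) : (L.gen k).Countable := by
  refine (L.disjoint k).countable_of_nonempty_interior fun I hI => ?_
  obtain ⟨a, b, hab, rfl⟩ := L.isIco k I hI
  simpa using hab

theorem measurableSet_X : MeasurableSet L.X := by
  rw [← L.cover 0]
  exact MeasurableSet.sUnion (countable_gen 0) fun I hI => measurableSet_of_mem_gen hI

end Basic

/-! ### The interval of a generation that contains a given point -/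

/-- The interval of generation `k` that contains `x` (empty if `x` is not in `X`). -/
def cell (k : ℤ) (x : ℝ) : Set ℝ := ⋃₀ {I | I ∈ L.gen k ∧ x ∈ I}

variable {L}

theorem cell_eq (hI : I ∈ L.gen k) (hx : x ∈ I) : L.cell k x = I := by
  have : {I | I ∈ L.gen k ∧ x ∈ I} = {I} := by
    ext J
    simp only [mem_ofPred_eq, mem_singleton_iff]
    exact ⟨fun h => eq_of_mem_gen h.1 hI h.2 hx, by rintro rfl; exact ⟨hI, hx⟩⟩
  rw [cell, this, sUnion_singleton]

theorem exists_mem_gen (k : ℤ) (hx : x ∈ L.X) : ∃ I ∈ L.gen k, x ∈ I := by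
  rw [← L.cover k] at hx
  exact hx

theorem cell_mem_gen (k : ℤ) (hx : x ∈ L.X) : L.cell k x ∈ L.gen k := by
  obtain ⟨I, hI, hxI⟩ := exists_mem_gen k hx
  rwa [cell_eq hI hxI]

theorem mem_cell (k : ℤ) (hx : x ∈ L.X) : x ∈ L.cell k x := by
  obtain ⟨I, hI, hxI⟩ := exists_mem_gen k hx
  rwa [cell_eq hI hxI]

theorem cell_of_notMem (k : ℤ) (hx : x ∉ L.X) : L.cell k x = ∅ := by
  rw [cell, sUnion_eq_empty]
  exact fun I hI => (hx (subset_X_of_mem_gen hI.1 hI.2)).elim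

theorem mem_X_iff_cell_ne_empty : x ∈ L.X ↔ L.cell k x ≠ ∅ := by
  refine ⟨fun h => (nonempty_of_mem_gen (cell_mem_gen k h)).ne_empty, fun h => ?_⟩
  by_contra hx
  exact h (cell_of_notMem k hx)

theorem cell_succ_subset (k : ℤ) (hx : x ∈ L.X) : L.cell (k + 1) x ⊆ L.cell k x := by
  have h := (L.refinement k _ (cell_mem_gen k hx)).2
  have hx' := mem_cell k hx
  rw [← h] at hx'
  obtain ⟨J, ⟨hJ, hJs⟩, hxJ⟩ := hx'
  rwa [cell_eq hJ hxJ]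

theorem cell_antitone (hx : x ∈ L.X) : Antitone fun k => L.cell k x :=
  antitone_int_of_succ_le fun k => cell_succ_subset k hx

theorem cell_eq_of_mem (hy : y ∈ L.cell k x) : L.cell k y = L.cell k x := by
  have hx : x ∈ L.X := mem_X_iff_cell_ne_empty.2 (Set.nonempty_iff_ne_empty.1 ⟨y, hy⟩)
  exact cell_eq (cell_mem_gen k hx) hy

/-- Cells shrink as the generation grows, so a cell that recurs at any later generation already
recurs at the next one. -/
theorem isRank_cell_iff (hx : x ∈ L.X) :
    L.IsRank (L.cell k x) k ↔ L.cell (k + 1) x ≠ L.cell k x := by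
  constructor
  · intro h he
    have h1 : L.cell k x ∈ L.gen (k + 1) := he ▸ cell_mem_gen (k + 1) hx
    have := h.2 h1
    omega
  · refine fun hne => ⟨cell_mem_gen k hx, fun j hj => ?_⟩
    by_contra! hkj
    have h1 : L.cell j x = L.cell k x := cell_eq hj (mem_cell k hx)
    exact hne ((cell_succ_subset k hx).antisymm (h1 ▸ cell_antitone hx (by omega : k + 1 ≤ j)))

/-! ### Functions that are constant on the intervals of a generation -/

variable (L) in
/-- `g` is constant on the intervals of generation `k` (and off `X`). -/
def Adapted {β : Type*} (k : ℤ) (g : ℝ → β) : Prop :=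
  ∀ x y, L.cell k x = L.cell k y → g x = g y

theorem cell_eq_cell_of_le (hmk : m ≤ k) (h : L.cell k x = L.cell k y) :
    L.cell m x = L.cell m y := by
  by_cases hx : x ∈ L.X
  · have hy : y ∈ L.X := by
      rw [mem_X_iff_cell_ne_empty (k := k), ← h]
      exact mem_X_iff_cell_ne_empty.1 hx
    have hxy : x ∈ L.cell k y := h ▸ mem_cell k hx
    exact cell_eq_of_mem (cell_antitone hy hmk hxy)
  · have hy : y ∉ L.X := by
      rw [mem_X_iff_cell_ne_empty (k := k), ← h, cell_of_notMem k hx]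
      simp
    rw [cell_of_notMem m hx, cell_of_notMem m hy]

theorem Adapted.mono {β : Type*} {g : ℝ → β} (h : L.Adapted m g) (hmk : m ≤ k) :
    L.Adapted k g :=
  fun x y hxy => h x y (cell_eq_cell_of_le hmk hxy)

theorem Adapted.eq_of_mem {β : Type*} {g : ℝ → β} (h : L.Adapted k g) (hI : I ∈ L.gen k)
    (hx : x ∈ I) (hy : y ∈ I) : g x = g y :=
  h x y ((cell_eq hI hx).trans (cell_eq hI hy).symm)

theorem Adapted.comp {β γ : Type*} {g : ℝ → β} (h : L.Adapted k g) (F : β → γ) :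
    L.Adapted k fun x => F (g x) :=
  fun x y hxy => congrArg F (h x y hxy)

theorem Adapted.comp₂ {β γ δ : Type*} {g : ℝ → β} {g' : ℝ → γ} (h : L.Adapted k g)
    (h' : L.Adapted k g') (F : β → γ → δ) : L.Adapted k fun x => F (g x) (g' x) :=
  fun x y hxy => congrArg₂ F (h x y hxy) (h' x y hxy)

theorem Adapted.sum {ι β : Type*} [AddCommMonoid β] {s : Finset ι} {g : ι → ℝ → β}
    (h : ∀ i ∈ s, L.Adapted k (g i)) : L.Adapted k fun x => ∑ i ∈ s, g i x :=
  fun x y hxy => Finset.sum_congr rfl fun i hi => h i hi x y hxy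

/-- Every preimage is a countable union of intervals of generation `k`, together with all or nothing
of the complement of `X`. -/
theorem Adapted.measurable {β : Type*} [MeasurableSpace β] {g : ℝ → β} (h : L.Adapted k g) :
    Measurable g := by
  intro s _
  have h1 : MeasurableSet (⋃₀ {I | I ∈ L.gen k ∧ I ⊆ g ⁻¹' s}) :=
    MeasurableSet.sUnion ((countable_gen k).mono fun I hI => hI.1)
      fun I hI => measurableSet_of_mem_gen hI.1
  have h2 : MeasurableSet (L.Xᶜ ∩ g ⁻¹' s) := by
    by_cases hne : (L.Xᶜ ∩ g ⁻¹' s).Nonempty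
    · obtain ⟨y, hy, hys⟩ := hne
      have : L.Xᶜ ∩ g ⁻¹' s = L.Xᶜ := by
        refine inter_eq_left.2 fun z hz => ?_
        rw [mem_preimage, h z y (by rw [cell_of_notMem k hz, cell_of_notMem k hy])]
        exact hys
      rw [this]
      exact measurableSet_X.compl
    · rw [Set.not_nonempty_iff_eq_empty.1 hne]
      exact MeasurableSet.empty
  convert h1.union h2 using 1
  ext z
  constructor
  · intro hz
    by_cases hzX : z ∈ L.X
    · refine Or.inl ⟨L.cell k z, ⟨cell_mem_gen k hzX, fun w hw => ?_⟩, mem_cell k hzX⟩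
      rw [mem_preimage, h w z (cell_eq_of_mem hw)]
      exact hz
    · exact Or.inr ⟨hzX, hz⟩
  · rintro (⟨I, ⟨_, hI⟩, hz⟩ | ⟨_, hz⟩)
    · exact hI hz
    · exact hz

theorem lintegral_X_eq_tsum (k : ℤ) (g : ℝ → ℝ≥0∞) :
    ∫⁻ x in L.X, g x = ∑' I : L.gen k, ∫⁻ x in (I : Set ℝ), g x := by
  rw [← lintegral_biUnion (s := fun I => I) (countable_gen k)
    (fun I hI => measurableSet_of_mem_gen hI) (L.disjoint k), ← sUnion_eq_biUnion, L.cover k]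

/-- This is how conditional inequalities enter below: Jensen is applied on single intervals, where
adapted factors are constants. -/
theorem lintegral_X_mono {g g' : ℝ → ℝ≥0∞} (k : ℤ)
    (h : ∀ I ∈ L.gen k, ∫⁻ x in I, g x ≤ ∫⁻ x in I, g' x) :
    ∫⁻ x in L.X, g x ≤ ∫⁻ x in L.X, g' x := by
  rw [lintegral_X_eq_tsum k, lintegral_X_eq_tsum k]
  exact ENNReal.tsum_le_tsum fun I => h I I.2

variable (L) in
/-- The average of `h` over the interval of generation `k`. -/
noncomputable def cellAvg (k : ℤ) (h : ℝ → ℝ≥0∞) (x : ℝ) : ℝ≥0∞ :=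
  (∫⁻ y in L.cell k x, h y) / volume (L.cell k x)

theorem adapted_cellAvg (k : ℤ) (h : ℝ → ℝ≥0∞) : L.Adapted k (L.cellAvg k h) :=
  fun x y hxy => by rw [cellAvg, cellAvg, hxy]

theorem cellAvg_mul_volume (h : ℝ → ℝ≥0∞) (hI : I ∈ L.gen k) (hx : x ∈ I) :
    L.cellAvg k h x * volume I = ∫⁻ y in I, h y := by
  rw [cellAvg, cell_eq hI hx, ENNReal.div_mul_cancel
    (volume_ne_zero_of_mem_gen hI) (volume_ne_top_of_mem_gen hI)]

theorem Adapted.setLIntegral {g : ℝ → ℝ≥0∞} (h : L.Adapted k g) (hI : I ∈ L.gen k) (hx : x ∈ I) :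
    ∫⁻ y in I, g y = g x * volume I := by
  rw [← setLIntegral_const]
  exact setLIntegral_congr_fun (measurableSet_of_mem_gen hI) fun y hy => h.eq_of_mem hI hy hx

theorem lintegral_cellAvg (k : ℤ) (h : ℝ → ℝ≥0∞) :
    ∫⁻ x in L.X, L.cellAvg k h x = ∫⁻ x in L.X, h x := by
  have : ∀ I ∈ L.gen k, ∫⁻ x in I, L.cellAvg k h x = ∫⁻ x in I, h x := by
    intro I hI
    obtain ⟨x, hx⟩ := nonempty_of_mem_gen hI
    rw [(adapted_cellAvg k h).setLIntegral hI hx, cellAvg_mul_volume h hI hx]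
  exact le_antisymm (lintegral_X_mono k fun I hI => (this I hI).le)
    (lintegral_X_mono k fun I hI => (this I hI).ge)

/-! ### The square functions as sums over the generations -/

variable {𝕜 : Type*} [RCLike 𝕜] (f : ℝ → 𝕜)

theorem intervalAvg_of_mem {E : Type*} [NormedAddCommGroup E] [NormedSpace ℝ E] (g : ℝ → E)
    (hx : x ∈ I) : intervalAvg I g x = ⨍ y in I, g y :=
  indicator_of_mem hx _

theorem intervalAvg_of_notMem {E : Type*} [NormedAddCommGroup E] [NormedSpace ℝ E] (g : ℝ → E)
    (hx : x ∉ I) : intervalAvg I g x = 0 :=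
  indicator_of_notMem hx _

theorem finsum_intervalAvg {S : Set (Set ℝ)} (hS : S.PairwiseDisjoint id) (hI : I ∈ S)
    (hx : x ∈ I) : ∑ᶠ J ∈ S, intervalAvg J f x = ⨍ y in I, f y := by
  rw [finsum_mem_def, finsum_eq_single _ I, indicator_of_mem hI, intervalAvg_of_mem f hx]
  intro J hJI
  by_cases hJ : J ∈ S
  · rw [indicator_of_mem hJ]
    exact intervalAvg_of_notMem f fun hxJ => hJI (hS.elim_set hJ hI x hxJ hx)
  · exact indicator_of_notMem hJ _

theorem condExp_eq (hI : I ∈ L.gen k) (hx : x ∈ I) : L.condExp k f x = ⨍ y in I, f y :=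
  finsum_intervalAvg f (L.disjoint k) hI hx

theorem condExp_of_notMem (hx : x ∉ L.X) : L.condExp k f x = 0 := by
  rw [condExp, finsum_mem_def]
  refine (finsum_congr fun J => ?_).trans finsum_zero
  by_cases hJ : J ∈ L.gen k
  · rw [indicator_of_mem hJ]
    exact intervalAvg_of_notMem f fun hxJ => hx (subset_X_of_mem_gen hJ hxJ)
  · exact indicator_of_notMem hJ _

theorem adapted_condExp (k : ℤ) : L.Adapted k (L.condExp k f) := by
  intro x y hxy
  by_cases hx : x ∈ L.X
  · have hy : y ∈ L.X := by
      rw [mem_X_iff_cell_ne_empty (k := k), ← hxy]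
      exact mem_X_iff_cell_ne_empty.1 hx
    rw [condExp_eq f (cell_mem_gen k hx) (mem_cell k hx),
      condExp_eq f (cell_mem_gen k hy) (mem_cell k hy), hxy]
  · have hy : y ∉ L.X := by
      rw [mem_X_iff_cell_ne_empty (k := k), ← hxy, cell_of_notMem k hx]
      simp
    rw [condExp_of_notMem f hx, condExp_of_notMem f hy]

theorem adapted_genDiff (k : ℤ) : L.Adapted k (L.genDiff k f) :=
  (adapted_condExp f k).comp₂ ((adapted_condExp f (k - 1)).mono (by omega)) fun a b => a - b

theorem genDiff_succ (k : ℤ) (x : ℝ) :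
    L.genDiff (k + 1) f x = L.condExp (k + 1) f x - L.condExp k f x := by
  rw [genDiff, add_sub_cancel_right]

theorem genDiff_succ_eq_zero (hx : x ∈ L.X) (h : L.cell (k + 1) x = L.cell k x) :
    L.genDiff (k + 1) f x = 0 := by
  rw [genDiff_succ, condExp_eq f (cell_mem_gen (k + 1) hx) (mem_cell (k + 1) hx),
    condExp_eq f (cell_mem_gen k hx) (mem_cell k hx), h, sub_self]

theorem IsRank.eq {j : ℤ} (hk : L.IsRank I k) (hj : L.IsRank I j) : k = j := IsGreatest.unique hk hj

theorem diff_eq_zero_of_forall_not_isRank (h : ∀ k, ¬ L.IsRank I k) : L.diff I f x = 0 :=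
  if_neg fun ⟨k, hk⟩ => h k hk

theorem diff_eq_genDiff (hI : L.IsRank I k) (hx : x ∈ I) :
    L.diff I f x = L.genDiff (k + 1) f x := by
  have hIg : I ∈ L.gen k := hI.1
  have hxX := subset_X_of_mem_gen hIg hx
  have hc : L.children I ⊆ L.gen (k + 1) := by
    rintro J ⟨j, hj, hJ, _⟩
    rwa [hI.eq hj]
  have hcell : L.cell (k + 1) x ∈ L.children I := by
    refine ⟨k, hI, cell_mem_gen _ hxX, ?_⟩
    rw [← cell_eq hIg hx]
    exact cell_succ_subset k hxX
  rw [diff, if_pos ⟨k, hI⟩, finsum_intervalAvg f ((L.disjoint (k + 1)).subset hc) hcell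
    (mem_cell _ hxX), genDiff_succ, condExp_eq f (cell_mem_gen _ hxX) (mem_cell _ hxX),
    condExp_eq f hIg hx, intervalAvg_of_mem f hx]

theorem diff_of_notMem (hx : x ∉ I) : L.diff I f x = 0 := by
  rw [diff]
  split_ifs with h
  · rw [intervalAvg_of_notMem f hx, sub_zero, finsum_mem_def]
    refine (finsum_congr fun J => ?_).trans finsum_zero
    by_cases hJ : J ∈ L.children I
    · rw [indicator_of_mem hJ]
      obtain ⟨_, _, _, hJI⟩ := hJ
      exact intervalAvg_of_notMem f fun hxJ => hx (hJI hxJ)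
    · exact indicator_of_notMem hJ _
  · rfl

/-- The generations at which the cell of `x` gets divided correspond bijectively, through `k ↦
L.cell k x`, to the intervals around `x` that have a rank. An interval present in many generations
is thus counted once, at its rank. -/
theorem tsum_intervals_eq_tsum_int (hx : x ∈ L.X) (G : Set ℝ → ℝ≥0∞) (H : ℤ → ℝ≥0∞)
    (hG : ∀ I, x ∉ I → G I = 0) (hG' : ∀ I, (∀ k, ¬ L.IsRank I k) → G I = 0)
    (hGH : ∀ k, L.cell (k + 1) x ≠ L.cell k x → G (L.cell k x) = H k)
    (hH : ∀ k, L.cell (k + 1) x = L.cell k x → H k = 0) :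
    ∑' I : L.intervals, G I = ∑' k, H k := by
  have hne : ∀ k : Function.support H, L.cell (k + 1) x ≠ L.cell k x := fun k h => k.2 (hH k h)
  refine tsum_eq_tsum_of_ne_zero_bij
    (fun k => ⟨L.cell k x, mem_intervals_of_mem_gen (cell_mem_gen k hx)⟩) ?_ ?_ ?_
  · intro j k hjk
    have h1 := (isRank_cell_iff hx).2 (hne j)
    have h2 := (isRank_cell_iff hx).2 (hne k)
    rw [Subtype.mk.injEq] at hjk
    rw [hjk] at h1
    exact Subtype.ext (h1.eq h2)
  · rintro ⟨I, hI⟩ hGI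
    rw [Function.mem_support] at hGI
    have hxI : x ∈ I := by
      by_contra h
      exact hGI (hG I h)
    obtain ⟨k, hk⟩ : ∃ k, L.IsRank I k := by
      by_contra! h
      exact hGI (hG' I h)
    have hcell : L.cell k x = I := cell_eq hk.1 hxI
    subst hcell
    refine ⟨⟨k, ?_⟩, rfl⟩
    rw [Function.mem_support, ← hGH k ((isRank_cell_iff hx).1 hk)]
    exact hGI
  · exact fun k => hGH k (hne k)

/-- The shift is intrinsic: the children of an interval of rank $k$ lie in generation $k+1$. -/
theorem squareFunction_eq (hx : x ∈ L.X) :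
    L.squareFunction f x = (∑' k, ‖L.genDiff (k + 1) f x‖ₑ ^ (2 : ℝ)) ^ (1 / 2 : ℝ) := by
  rw [squareFunction, tsum_intervals_eq_tsum_int hx (fun I => ‖L.diff I f x‖ₑ ^ (2 : ℝ))]
  · intro I hI
    simp [diff_of_notMem f hI]
  · intro I hI
    simp [diff_eq_zero_of_forall_not_isRank f hI]
  · intro k hk
    rw [diff_eq_genDiff f ((isRank_cell_iff hx).2 hk) (mem_cell k hx)]
  · intro k hk
    simp [genDiff_succ_eq_zero f hx hk]

theorem Adapted.integrableOn {g : ℝ → ℝ} (hg : L.Adapted (k + 1) g) (hI : I ∈ L.gen k) :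
    IntegrableOn g I := by
  obtain ⟨hfin, hU⟩ := L.refinement k I hI
  rw [← hU, sUnion_eq_biUnion, integrableOn_finite_biUnion hfin]
  rintro J ⟨hJ, -⟩
  obtain ⟨x, hx⟩ := nonempty_of_mem_gen hJ
  refine (integrableOn_const (C := g x) (volume_ne_top_of_mem_gen hJ)).congr_fun
    (fun y hy => hg.eq_of_mem hJ hx hy) (measurableSet_of_mem_gen hJ)

/-- Since `I` is a finite union of intervals of the next generation, `g` is integrable on it, and
the Bochner average is a genuine average rather than the default value 0. -/
theorem enorm_setAverage_eq {g : ℝ → ℝ} (hg : L.Adapted (k + 1) g) (hg0 : ∀ x, 0 ≤ g x)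
    (hI : I ∈ L.gen k) (hx : x ∈ I) :
    ‖⨍ y in I, g y‖ₑ = L.cellAvg k (fun y => ‖g y‖ₑ) x := by
  have h1 : ∫⁻ y in I, ‖g y‖ₑ = ‖∫ y in I, g y‖ₑ := by
    rw [Real.enorm_of_nonneg (integral_nonneg hg0),
      ofReal_integral_eq_lintegral_ofReal (hg.integrableOn hI) (ae_of_all _ hg0)]
    exact lintegral_congr fun y => Real.enorm_of_nonneg (hg0 y)
  rw [cellAvg, cell_eq hI hx, h1, setAverage_eq, enorm_smul,
    ENNReal.div_eq_inv_mul]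
  congr 1
  have : 0 < volume.real I :=
    ENNReal.toReal_pos (volume_ne_zero_of_mem_gen hI) (volume_ne_top_of_mem_gen hI)
  rw [enorm_inv this.ne', Real.enorm_of_nonneg this.le, Measure.real,
    ENNReal.ofReal_toReal (volume_ne_top_of_mem_gen hI)]

theorem avgSquareFunction_eq {p : ℝ} (hp : 0 < p) (hx : x ∈ L.X) :
    L.avgSquareFunction p f x =
      (∑' k, L.cellAvg k (fun y => ‖L.genDiff (k + 1) f y‖ₑ ^ p) x ^ (2 / p)) ^ (1 / 2 : ℝ) := by
  have h2p : 0 < 2 / p := by positivity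
  rw [avgSquareFunction, tsum_intervals_eq_tsum_int hx (fun I =>
    ‖intervalAvg (I : Set ℝ) (fun y => ‖L.diff I f y‖ ^ p) x‖ₑ ^ (2 / p))]
  · intro I hI
    simp [intervalAvg_of_notMem _ hI, h2p]
  · intro I hI
    have : (fun y => ‖L.diff I f y‖ ^ p) = fun _ => 0 := by
      funext y
      rw [diff_eq_zero_of_forall_not_isRank f hI, norm_zero, Real.zero_rpow hp.ne']
    rw [this]
    simp [intervalAvg, h2p]
  · intro k hk
    have hI := cell_mem_gen k hx
    have h1 : ⨍ y in L.cell k x, ‖L.diff (L.cell k x) f y‖ ^ p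
        = ⨍ y in L.cell k x, ‖L.genDiff (k + 1) f y‖ ^ p := by
      rw [setAverage_eq, setAverage_eq]
      congr 1
      refine setIntegral_congr_fun (measurableSet_of_mem_gen hI) fun y hy => ?_
      rw [diff_eq_genDiff f ((isRank_cell_iff hx).2 hk) hy]
    rw [intervalAvg_of_mem _ (mem_cell k hx), h1, enorm_setAverage_eq
      ((adapted_genDiff f (k + 1)).comp fun a => ‖a‖ ^ p) (fun y => by positivity) hI
      (mem_cell k hx)]
    congr 3
    funext y
    rw [Real.enorm_rpow_of_nonneg (norm_nonneg _) hp.le, enorm_norm]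
  · intro k hk
    have : ∫⁻ y in L.cell k x, ‖L.genDiff (k + 1) f y‖ₑ ^ p = 0 := by
      rw [setLIntegral_congr_fun (g := fun _ => 0) (measurableSet_of_mem_gen (cell_mem_gen k hx))]
      · simp
      · intro y hy
        have hyX := subset_X_of_mem_gen (cell_mem_gen k hx) hy
        have hy1 : L.cell (k + 1) y = L.cell k y := by
          rw [cell_eq_of_mem hy, ← hk]
          exact cell_eq_of_mem (hk ▸ hy)
        simp [genDiff_succ_eq_zero f hyX hy1, hp]
    rw [cellAvg, this]
    simp [h2p]

theorem squareFunction_le_extSquareFunction (hx : x ∈ L.X) :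
    L.squareFunction f x ≤ L.extSquareFunction f x := by
  rw [squareFunction_eq f hx, extSquareFunction,
    ← (Equiv.addRight (1 : ℤ)).tsum_eq (fun k => ‖L.genDiff k f x‖ₑ ^ (2 : ℝ))]
  exact ENNReal.rpow_le_rpow le_self_add (by norm_num)

theorem lpNorm_eq {p : ℝ} (hp : 0 < p) (g : ℝ → ℝ≥0∞) :
    L.lpNorm p g = (∫⁻ x in L.X, g x ^ p) ^ (1 / p) := by
  rw [lpNorm, eLpNorm_eq_lintegral_rpow_enorm_toReal (by simpa using hp) ENNReal.ofReal_ne_top,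
    ENNReal.toReal_ofReal hp.le]
  rfl

end IntervalLattice

/-! ### Inequalities for powers of extended nonnegative numbers -/

namespace ENNReal

theorem Lp_add_le_two {r : ℝ} (hr : 1 ≤ r) (a b c d : ℝ≥0∞) :
    ((a + c) ^ r + (b + d) ^ r) ^ (1 / r) ≤ (a ^ r + b ^ r) ^ (1 / r) + (c ^ r + d ^ r) ^ (1 / r) := by
  simpa using ENNReal.Lp_add_le Finset.univ ![a, b] ![c, d] hr

theorem rpow_rpow_one_div {r : ℝ} (hr : r ≠ 0) (a : ℝ≥0∞) : (a ^ r) ^ (1 / r) = a := by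
  rw [← ENNReal.rpow_mul, mul_one_div_cancel hr, ENNReal.rpow_one]

theorem rpow_one_div_rpow {r : ℝ} (hr : r ≠ 0) (a : ℝ≥0∞) : (a ^ (1 / r)) ^ r = a := by
  rw [← ENNReal.rpow_mul, one_div_mul_cancel hr, ENNReal.rpow_one]

theorem rpow_sub_one_mul_self {q : ℝ} (hq : 1 ≤ q) (a : ℝ≥0∞) : a ^ (q - 1) * a = a ^ q := by
  have := ENNReal.rpow_add_of_nonneg (x := a) (q - 1) 1 (by linarith) zero_le_one
  rw [sub_add_cancel, ENNReal.rpow_one] at this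
  exact this.symm

theorem le_rpow_add_rpow_left {r : ℝ} (hr : 0 < r) (a b : ℝ≥0∞) :
    a ≤ (a ^ r + b ^ r) ^ (1 / r) := by
  conv_lhs => rw [← rpow_rpow_one_div hr.ne' a]
  exact ENNReal.rpow_le_rpow le_self_add (by positivity)

/-- Minkowski for $(b,h)=(a,h)+(b-a,0)$: the $\ell^r$ norm grows by at most $b-a$. For $b=\infty$
the truncated difference is 0. -/
theorem rpow_add_rpow_tsub_antitone {r : ℝ} (hr : 1 ≤ r) {a b : ℝ≥0∞} (hab : a ≤ b)
    (h : ℝ≥0∞) : (b ^ r + h ^ r) ^ (1 / r) - b ≤ (a ^ r + h ^ r) ^ (1 / r) - a := by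
  have hr0 : 0 < r := by positivity
  rcases eq_or_ne b ∞ with rfl | hb
  · simp
  have ha : a ≠ ∞ := ne_top_of_le_ne_top hb hab
  have h1 : (b ^ r + h ^ r) ^ (1 / r) ≤ (a ^ r + h ^ r) ^ (1 / r) + (b - a) := by
    have := Lp_add_le_two hr a h (b - a) 0
    rwa [add_tsub_cancel_of_le hab, add_zero, ENNReal.zero_rpow_of_pos hr0, add_zero,
      rpow_rpow_one_div hr0.ne'] at this
  rw [tsub_le_iff_right]
  refine h1.trans_eq ?_
  have h2 := le_rpow_add_rpow_left hr0 a h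
  conv_rhs => rw [← add_tsub_cancel_of_le hab, ← add_assoc, tsub_add_cancel_of_le h2]

/-- Jensen's inequality for the convex function `t ↦ (z ^ r + t ^ r) ^ (1 / r)`. -/
theorem rpow_add_rpow_mul_measure_le {α : Type*} [MeasurableSpace α] (μ : Measure α) {r : ℝ}
    (hr : 1 ≤ r) (z e : ℝ≥0∞) {g : α → ℝ≥0∞} (hg : Measurable g)
    (hge : ∫⁻ x, g x ∂μ = e * μ univ) :
    (z ^ r + e ^ r) ^ (1 / r) * μ univ ≤ ∫⁻ x, (z ^ r + g x ^ r) ^ (1 / r) ∂μ := by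
  have hr0 : 0 < r := by positivity
  have hz : z * μ univ ≤ ∫⁻ x, (z ^ r + g x ^ r) ^ (1 / r) ∂μ := by
    rw [← lintegral_const]
    exact lintegral_mono fun x => le_rpow_add_rpow_left hr0 z (g x)
  have he : e * μ univ ≤ ∫⁻ x, (z ^ r + g x ^ r) ^ (1 / r) ∂μ := by
    rw [← hge]
    refine lintegral_mono fun x => ?_
    simp only
    rw [add_comm]
    exact le_rpow_add_rpow_left hr0 (g x) z
  rcases hr.eq_or_lt with rfl | hr1
  · simp only [ENNReal.rpow_one, div_one]
    rw [lintegral_add_left measurable_const, lintegral_const, hge, add_mul]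
  set N := (z ^ r + e ^ r) ^ (1 / r) with hN
  rcases eq_or_ne N 0 with h0 | h0
  · simp [h0]
  rcases eq_or_ne N ∞ with ht | ht
  · have : z = ∞ ∨ e = ∞ := by
      rw [hN, ENNReal.rpow_eq_top_iff_of_pos (by positivity), ENNReal.add_eq_top,
        ENNReal.rpow_eq_top_iff_of_pos hr0, ENNReal.rpow_eq_top_iff_of_pos hr0] at ht
      exact ht
    rcases this with h | h
    · rwa [ht, ← h]
    · rwa [ht, ← h]
  have hpow : ∀ t : ℝ≥0∞, t * t ^ (r - 1) = t ^ r := fun t => by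
    rw [mul_comm, rpow_sub_one_mul_self hr]
  have hconj := Real.HolderConjugate.conjExponent hr1
  have hq : 1 / r.conjExponent = (r - 1) * (1 / r) := by
    rw [Real.conjExponent]
    field_simp
  -- Supporting line at $t=e$, multiplied by $N^{r-1}$: Hölder for the vector $(z,g(x))$ against
  -- $(z^{r-1},e^{r-1})$. Equality holds when $g(x)=e$.
  have key : ∀ x, z ^ r + e ^ (r - 1) * g x ≤ N ^ (r - 1) * (z ^ r + g x ^ r) ^ (1 / r) := by
    intro x
    have := ENNReal.inner_le_Lp_mul_Lq Finset.univ ![z, g x] ![z ^ (r - 1), e ^ (r - 1)] hconj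
    simp only [Fin.sum_univ_two, Matrix.cons_val_zero, Matrix.cons_val_one, hpow,
      ← ENNReal.rpow_mul, hconj.sub_one_mul_conj] at this
    rw [mul_comm (e ^ (r - 1)), mul_comm (N ^ (r - 1)), hN, ← ENNReal.rpow_mul,
      mul_comm (1 / r) (r - 1), ← hq]
    exact this
  have hint : N ^ (r - 1) * (N * μ univ)
      ≤ N ^ (r - 1) * ∫⁻ x, (z ^ r + g x ^ r) ^ (1 / r) ∂μ := by
    have hm : Measurable fun x => (z ^ r + g x ^ r) ^ (1 / r) := by fun_prop
    rw [← lintegral_const_mul _ hm]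
    refine le_trans (le_of_eq ?_) (lintegral_mono key)
    rw [lintegral_add_left measurable_const, lintegral_const, lintegral_const_mul _ hg, hge,
      ← mul_assoc, ← mul_assoc, mul_comm (N ^ (r - 1)), hpow, mul_comm (e ^ (r - 1)), hpow,
      ← add_mul, hN, rpow_one_div_rpow hr0.ne']
  rwa [ENNReal.mul_le_mul_iff_right] at hint
  · exact (ENNReal.rpow_pos (pos_iff_ne_zero.2 h0) ht).ne'
  · exact ENNReal.rpow_ne_top_of_nonneg (by linarith) ht

/-- If $a\le b$, use $a+b\le2b$. Otherwise $1+b/a$ is a convex combination of 1 and 2 with weight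
$b/a\le1$ on 2, and convexity of $t^q$ gives the linear term. -/
theorem add_rpow_le_add_mul {q : ℝ} (hq : 1 ≤ q) (a b : ℝ≥0∞) :
    (a + b) ^ q ≤ a ^ q + 2 ^ q * (a ^ (q - 1) * b + b ^ q) := by
  have hq0 : 0 ≤ q := by linarith
  rcases le_or_gt a b with hab | hab
  · calc (a + b) ^ q ≤ (2 * b) ^ q := by
          rw [two_mul]
          gcongr
      _ = 2 ^ q * b ^ q := ENNReal.mul_rpow_of_nonneg _ _ hq0
      _ ≤ 2 ^ q * (a ^ (q - 1) * b + b ^ q) := by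
          gcongr
          exact le_add_self
      _ ≤ _ := le_add_self
  rcases eq_or_ne a ∞ with rfl | ha
  · simp [ENNReal.top_rpow_of_pos (by linarith : 0 < q)]
  have ha0 : a ≠ 0 := (pos_of_gt hab).ne'
  have hw : b / a ≤ 1 := ENNReal.div_le_of_le_mul (by simpa using hab.le)
  have hab' : a + b = a * ((1 - b / a) * 1 + b / a * 2) := by
    rw [mul_one, mul_two, ← add_assoc, tsub_add_cancel_of_le hw, mul_add, mul_one,
      ENNReal.mul_div_cancel ha0 ha]
  have hpow : a ^ q * (b / a) = a ^ (q - 1) * b := by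
    rw [ENNReal.rpow_sub _ _ ha0 ha, ENNReal.rpow_one, div_eq_mul_inv, div_eq_mul_inv]
    ring
  calc (a + b) ^ q = a ^ q * ((1 - b / a) * 1 + b / a * 2) ^ q := by
        rw [hab', ENNReal.mul_rpow_of_nonneg _ _ hq0]
    _ ≤ a ^ q * ((1 - b / a) * 1 ^ q + b / a * 2 ^ q) := by
        gcongr
        exact ENNReal.rpow_arith_mean_le_arith_mean2_rpow _ _ _ _ (tsub_add_cancel_of_le hw) hq
    _ ≤ a ^ q * (1 + b / a * 2 ^ q) := by
        gcongr
        rw [ENNReal.one_rpow, mul_one]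
        exact tsub_le_self
    _ = a ^ q + 2 ^ q * (a ^ (q - 1) * b) := by
        rw [mul_add, mul_one, ← mul_assoc, hpow, mul_comm (2 ^ q)]
    _ ≤ _ := by
        gcongr
        exact le_self_add

/-- A form of Young's inequality with small parameter: the first term dominates when $b\le\delta a$,
the second when $a\le\delta^{-1}b$. -/
theorem rpow_sub_one_mul_le {q : ℝ} (hq : 1 ≤ q) {δ : ℝ≥0∞} (h0 : δ ≠ 0) (ht : δ ≠ ∞)
    (a b : ℝ≥0∞) : a ^ (q - 1) * b ≤ δ * a ^ q + (δ⁻¹) ^ (q - 1) * b ^ q := by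
  have hq' : 0 ≤ q - 1 := by linarith
  rcases le_total b (δ * a) with h | h
  · calc a ^ (q - 1) * b ≤ a ^ (q - 1) * (δ * a) := by gcongr
      _ = δ * (a ^ (q - 1) * a) := by ring
      _ = δ * a ^ q := by rw [rpow_sub_one_mul_self hq]
      _ ≤ _ := le_self_add
  · have ha : a ≤ δ⁻¹ * b := by
      rw [mul_comm, ← div_eq_mul_inv, ENNReal.le_div_iff_mul_le (Or.inl h0) (Or.inl ht), mul_comm]
      exact h
    calc a ^ (q - 1) * b ≤ (δ⁻¹ * b) ^ (q - 1) * b := by gcongr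
      _ = (δ⁻¹) ^ (q - 1) * (b ^ (q - 1) * b) := by
          rw [ENNReal.mul_rpow_of_nonneg _ _ hq', mul_assoc]
      _ = (δ⁻¹) ^ (q - 1) * b ^ q := by rw [rpow_sub_one_mul_self hq]
      _ ≤ _ := le_add_self

/-- Jensen's inequality for the concave function `t ↦ t ^ r`, `0 < r ≤ 1`. -/
theorem lintegral_rpow_le_rpow_mul {α : Type*} [MeasurableSpace α] (μ : Measure α) {r : ℝ}
    (hr0 : 0 < r) (hr : r ≤ 1) (e : ℝ≥0∞) {g : α → ℝ≥0∞} (hg : Measurable g)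
    (hμ : μ univ ≠ 0) (hμ' : μ univ ≠ ∞) (hge : ∫⁻ x, g x ∂μ = e * μ univ) :
    ∫⁻ x, g x ^ r ∂μ ≤ e ^ r * μ univ := by
  have h := eLpNorm'_le_eLpNorm'_mul_rpow_measure_univ (μ := μ) hr0 hr hg.aestronglyMeasurable
  simp only [eLpNorm', enorm_eq_self, ENNReal.rpow_one, div_one] at h
  rw [hge] at h
  have h' := ENNReal.rpow_le_rpow h hr0.le
  rw [rpow_one_div_rpow hr0.ne', ENNReal.mul_rpow_of_nonneg _ _ hr0.le,
    ENNReal.mul_rpow_of_nonneg _ _ hr0.le, ← ENNReal.rpow_mul, mul_assoc,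
    ← ENNReal.rpow_add _ _ hμ hμ'] at h'
  refine h'.trans_eq ?_
  rw [sub_mul, one_div_mul_cancel hr0.ne', one_mul, add_sub_cancel, ENNReal.rpow_one]

end ENNReal

/-! ### Inequalities between adapted sequences and their conditional averages -/

namespace IntervalLattice

variable {L : IntervalLattice} {k m : ℤ} {I J : Set ℝ} {x y : ℝ}

theorem sum_range_add_le_tsum (g : ℤ → ℝ≥0∞) (m : ℤ) (n : ℕ) :
    ∑ i ∈ Finset.range n, g (m + i) ≤ ∑' k, g k := by
  have := ENNReal.sum_le_tsum (f := g)
    ((Finset.range n).map (Nat.castEmbedding.trans (addLeftEmbedding m)))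
  simpa using this

/-- Monotone convergence along the windows $-n\le k<n$. It reduces two-sided sums to finitely many
consecutive generations, where induction is available. -/
theorem lintegral_tsum_rpow_le {μ : Measure ℝ} {u : ℤ → ℝ → ℝ≥0∞} (hu : ∀ k, Measurable (u k))
    {s : ℝ} (hs : 0 < s) {C : ℝ≥0∞}
    (h : ∀ (m : ℤ) (n : ℕ), ∫⁻ x, (∑ i ∈ Finset.range n, u (m + i) x) ^ s ∂μ ≤ C) :
    ∫⁻ x, (∑' k, u k x) ^ s ∂μ ≤ C := by
  let S : ℕ → Finset ℤ := fun n =>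
    (Finset.range (2 * n)).map (Nat.castEmbedding.trans (addLeftEmbedding (-(n : ℤ))))
  have hmem : ∀ n k, k ∈ S n ↔ -(n : ℤ) ≤ k ∧ k < n := by
    intro n k
    simp only [S, Finset.mem_map, Finset.mem_range, Function.Embedding.trans_apply,
      Nat.castEmbedding_apply, addLeftEmbedding_apply]
    constructor
    · rintro ⟨i, hi, rfl⟩
      omega
    · rintro ⟨h1, h2⟩
      exact ⟨(k + n).toNat, by omega, by omega⟩
  have hS : ∀ t : Finset ℤ, ∃ n, t ⊆ S n := by
    intro t
    refine ⟨t.sup Int.natAbs + 1, fun k hk => ?_⟩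
    have : k.natAbs ≤ t.sup Int.natAbs := Finset.le_sup (f := Int.natAbs) hk
    rw [hmem]
    omega
  have hmono : Monotone S := by
    intro a b hab k hk
    rw [hmem] at hk ⊢
    omega
  have h1 : ∀ x, (∑' k, u k x) ^ s = ⨆ n, (∑ k ∈ S n, u k x) ^ s := by
    intro x
    rw [ENNReal.tsum_eq_iSup_sum' S hS]
    exact (ENNReal.orderIsoRpow s hs).map_iSup _
  simp_rw [h1]
  rw [lintegral_iSup]
  · refine iSup_le fun n => ?_
    simpa [S] using h (-n) (2 * n)
  · intro n
    exact (Finset.measurable_sum _ fun k _ => hu k).pow_const s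
  · intro a b hab x
    exact ENNReal.rpow_le_rpow (Finset.sum_le_sum_of_subset (hmono hab)) hs.le

/-- The inequality of Lépingle, for finitely many generations. -/
theorem lintegral_sum_cellAvg_le {r : ℝ} (hr : 1 ≤ r) {h : ℤ → ℝ → ℝ≥0∞}
    (hh : ∀ k, L.Adapted (k + 1) (h k)) (m : ℤ) (n : ℕ) :
    ∫⁻ x in L.X, (∑ i ∈ Finset.range n, L.cellAvg (m + i) (h (m + i)) x ^ r) ^ (1 / r)
      ≤ 2 * ∫⁻ x in L.X, (∑ i ∈ Finset.range n, h (m + i) x ^ r) ^ (1 / r) := by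
  have hr0 : 0 < r := by positivity
  set e : ℤ → ℝ → ℝ≥0∞ := fun k => L.cellAvg k (h k) with he
  set Z : ℕ → ℝ → ℝ≥0∞ := fun n x =>
    (∑ i ∈ Finset.range n, (e (m + i) x ^ r + h (m + i) x ^ r)) ^ (1 / r) with hZ
  set B : ℕ → ℝ → ℝ≥0∞ := fun n x => (∑ i ∈ Finset.range n, h (m + i) x ^ r) ^ (1 / r) with hB
  -- The increment of an $\ell^r$ norm $a$ when an entry $b$ is appended.
  set φ : ℝ≥0∞ → ℝ≥0∞ → ℝ≥0∞ := fun a b => (a ^ r + b ^ r) ^ (1 / r) - a with hφ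
  have hadd : ∀ a b, a + φ a b = (a ^ r + b ^ r) ^ (1 / r) := fun a b =>
    add_tsub_cancel_of_le (ENNReal.le_rpow_add_rpow_left hr0 a b)
  have hae : ∀ k, L.Adapted k (e k) := fun k => adapted_cellAvg k _
  have hZa : ∀ n : ℕ, L.Adapted (m + n) (Z n) := by
    intro n
    refine (Adapted.sum fun i hi => ?_).comp fun a => a ^ (1 / r)
    rw [Finset.mem_range] at hi
    exact ((hae _).mono (by omega)).comp₂ ((hh _).mono (by omega)) fun a b => a ^ r + b ^ r
  have hBa : ∀ n : ℕ, L.Adapted (m + n) (B n) := by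
    intro n
    refine (Adapted.sum fun i hi => ?_).comp fun a => a ^ (1 / r)
    rw [Finset.mem_range] at hi
    exact ((hh _).mono (by omega)).comp fun b => b ^ r
  have hBZ : ∀ n x, B n x ≤ Z n x := fun n x =>
    ENNReal.rpow_le_rpow (Finset.sum_le_sum fun i _ => le_add_self) (by positivity)
  have hBsucc : ∀ n x, B (n + 1) x = B n x + φ (B n x) (h (m + n) x) := by
    intro n x
    rw [hadd]
    simp only [hB, Finset.sum_range_succ]
    rw [ENNReal.rpow_one_div_rpow hr0.ne']
  -- Append `e` first and `h` second. The second increment starts from a value at least `B n x`, so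
  -- antitonicity bounds it by the increment of `B`.
  have hZsucc : ∀ n x, Z (n + 1) x
      ≤ Z n x + φ (Z n x) (e (m + n) x) + φ (B n x) (h (m + n) x) := by
    intro n x
    rw [hadd]
    have h1 : Z (n + 1) x = (((Z n x ^ r + e (m + n) x ^ r) ^ (1 / r)) ^ r
        + h (m + n) x ^ r) ^ (1 / r) := by
      simp only [hZ, Finset.sum_range_succ]
      rw [ENNReal.rpow_one_div_rpow hr0.ne', ENNReal.rpow_one_div_rpow hr0.ne', add_assoc]
    rw [h1, ← hadd]
    gcongr
    exact ENNReal.rpow_add_rpow_tsub_antitone hr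
      ((hBZ n x).trans (ENNReal.le_rpow_add_rpow_left hr0 _ _)) _
  -- On an interval of generation `m + n`, `Z n` is constant and `e` is the average of `h`. Jensen
  -- replaces `e` by `h`, then antitonicity replaces `Z n` by `B n`.
  have hJensen : ∀ n : ℕ, ∫⁻ x in L.X, φ (Z n x) (e (m + n) x)
      ≤ ∫⁻ x in L.X, φ (B n x) (h (m + n) x) := by
    intro n
    refine le_trans (lintegral_X_mono (m + n) fun I hI => ?_) (lintegral_mono fun x =>
      ENNReal.rpow_add_rpow_tsub_antitone hr (hBZ n x) _)
    obtain ⟨y, hy⟩ := nonempty_of_mem_gen hI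
    rw [((hZa n).comp₂ (hae (m + n)) φ).setLIntegral hI hy]
    have h1 : ∫⁻ x in I, φ (Z n x) (h (m + n) x) = ∫⁻ x in I, φ (Z n y) (h (m + n) x) :=
      setLIntegral_congr_fun (measurableSet_of_mem_gen hI) fun x hx => by
        rw [(hZa n).eq_of_mem hI hx hy]
    have h2 := ENNReal.rpow_add_rpow_mul_measure_le (volume.restrict I) hr (Z n y) (e (m + n) y)
      (hh (m + n)).measurable (by
        rw [Measure.restrict_apply_univ]
        exact (cellAvg_mul_volume _ hI hy).symm)
    simp only [← hadd] at h2
    rw [lintegral_add_left measurable_const, lintegral_const, add_mul,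
      Measure.restrict_apply_univ] at h2
    rw [← h1] at h2
    change _ ≤ ∫⁻ x in I, φ (Z n x) (h (m + n) x)
    rcases eq_or_ne (Z n y) ∞ with ht | ht
    · simp [hφ, ht]
    · rwa [ENNReal.add_le_add_iff_left
        (ENNReal.mul_ne_top ht (volume_ne_top_of_mem_gen hI))] at h2
  have hφm : ∀ n : ℕ, Measurable fun x => φ (B n x) (h (m + n) x) := fun n =>
    (((hBa n).mono (by omega)).comp₂ (hh (m + n)) φ).measurable
  have hφm' : ∀ n : ℕ, Measurable fun x => φ (Z n x) (e (m + n) x) := fun n =>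
    ((hZa n).comp₂ (hae (m + n)) φ).measurable
  have hBsum : ∀ n, ∫⁻ x in L.X, B n x
      = ∑ i ∈ Finset.range n, ∫⁻ x in L.X, φ (B i x) (h (m + i) x) := by
    intro n
    rw [← lintegral_finsetSum _ fun i _ => hφm i]
    refine lintegral_congr fun x => ?_
    induction n with
    | zero => simp [hB, hr0]
    | succ n ih => rw [Finset.sum_range_succ, ← ih, hBsucc]
  -- Each increment of `B` is paid for twice, once for `e` and once for `h`; hence the factor 2.
  have hZsum : ∀ n, ∫⁻ x in L.X, Z n x
      ≤ 2 * ∑ i ∈ Finset.range n, ∫⁻ x in L.X, φ (B i x) (h (m + i) x) := by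
    intro n
    induction n with
    | zero => simp [hZ, hr0]
    | succ n ih =>
      refine (lintegral_mono (hZsucc n)).trans ?_
      rw [lintegral_add_right _ (hφm n), lintegral_add_right _ (hφm' n), Finset.sum_range_succ,
        mul_add, two_mul (∫⁻ x in L.X, φ (B n x) (h (m + n) x)), add_assoc]
      exact add_le_add ih (add_le_add_left (hJensen n) _)
  calc _ ≤ ∫⁻ x in L.X, Z n x := lintegral_mono fun x =>
        ENNReal.rpow_le_rpow (Finset.sum_le_sum fun i _ => le_self_add) (by positivity)
    _ ≤ _ := hZsum n
    _ = _ := by rw [← hBsum]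

theorem lintegral_tsum_cellAvg_le {r : ℝ} (hr : 1 ≤ r) {h : ℤ → ℝ → ℝ≥0∞}
    (hh : ∀ k, L.Adapted (k + 1) (h k)) :
    ∫⁻ x in L.X, (∑' k, L.cellAvg k (h k) x ^ r) ^ (1 / r)
      ≤ 2 * ∫⁻ x in L.X, (∑' k, h k x ^ r) ^ (1 / r) := by
  have hr0 : 0 < r := by positivity
  refine lintegral_tsum_rpow_le (fun k => ((adapted_cellAvg k _).measurable).pow_const r)
    (by positivity) fun m n => (lintegral_sum_cellAvg_le hr hh m n).trans ?_
  gcongr with x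
  exact sum_range_add_le_tsum (fun k => h k x ^ r) m n

/-- Finiteness of the left side is what permits half of it to be absorbed at the end. -/
theorem lintegral_sum_rpow_le_cellAvg {q : ℝ} (hq : 1 ≤ q) {h : ℤ → ℝ → ℝ≥0∞}
    (hh : ∀ k, L.Adapted (k + 1) (h k)) (m : ℤ) (n : ℕ)
    (hfin : ∫⁻ x in L.X, (∑ i ∈ Finset.range n, h (m + i) x ^ (1 / q)) ^ q ≠ ∞) :
    ∫⁻ x in L.X, (∑ i ∈ Finset.range n, h (m + i) x ^ (1 / q)) ^ q
      ≤ 2 * (2 ^ q * ((2 * 2 ^ q) ^ (q - 1) + 1)) *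
        ∫⁻ x in L.X, (∑ i ∈ Finset.range n, L.cellAvg (m + i) (h (m + i)) x ^ (1 / q)) ^ q := by
  have hq0 : 0 < q := by positivity
  have hq1 : 0 ≤ q - 1 := by linarith
  have hr1 : 1 / q ≤ 1 := by rwa [div_le_one hq0]
  set e : ℤ → ℝ → ℝ≥0∞ := fun k => L.cellAvg k (h k) with he
  set S : ℕ → ℝ → ℝ≥0∞ := fun n x => ∑ i ∈ Finset.range n, h (m + i) x ^ (1 / q) with hS
  set T : ℕ → ℝ → ℝ≥0∞ := fun n x => ∑ i ∈ Finset.range n, e (m + i) x ^ (1 / q) with hT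
  have hae : ∀ k, L.Adapted k (e k) := fun k => adapted_cellAvg k _
  have hSa : ∀ n : ℕ, L.Adapted (m + n) (S n) := by
    intro n
    refine Adapted.sum fun i hi => ?_
    rw [Finset.mem_range] at hi
    exact ((hh _).mono (by omega)).comp fun b => b ^ (1 / q)
  have hSm : ∀ n, Measurable (S n) := fun n => (hSa n).measurable
  have hTm : ∀ n, Measurable (T n) := fun n =>
    Finset.measurable_sum _ fun i _ => (hae _).measurable.pow_const _
  have hstep : ∀ n x, S (n + 1) x ^ q
      ≤ S n x ^ q + 2 ^ q * (S n x ^ (q - 1) * h (m + n) x ^ (1 / q) + h (m + n) x) := by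
    intro n x
    have := ENNReal.add_rpow_le_add_mul hq (S n x) (h (m + n) x ^ (1 / q))
    rw [ENNReal.rpow_one_div_rpow hq0.ne'] at this
    simpa only [hS, Finset.sum_range_succ] using this
  -- On each interval of generation `m + n` the factor in `S n` is constant, and Jensen for the
  -- concave power $1/q$ applies to the other one.
  have hJensen : ∀ n : ℕ, ∫⁻ x in L.X, S n x ^ (q - 1) * h (m + n) x ^ (1 / q)
      ≤ ∫⁻ x in L.X, S n x ^ (q - 1) * e (m + n) x ^ (1 / q) := by
    intro n
    refine lintegral_X_mono (m + n) fun I hI => ?_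
    obtain ⟨y, hy⟩ := nonempty_of_mem_gen hI
    rw [((hSa n).comp₂ (hae (m + n)) fun a b => a ^ (q - 1) * b ^ (1 / q)).setLIntegral hI hy]
    have h1 : ∫⁻ x in I, S n x ^ (q - 1) * h (m + n) x ^ (1 / q)
        = ∫⁻ x in I, S n y ^ (q - 1) * h (m + n) x ^ (1 / q) :=
      setLIntegral_congr_fun (measurableSet_of_mem_gen hI) fun x hx => by
        rw [(hSa n).eq_of_mem hI hx hy]
    rw [h1, lintegral_const_mul _ ((hh (m + n)).measurable.pow_const _), mul_assoc]
    gcongr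
    have h2 := ENNReal.lintegral_rpow_le_rpow_mul (volume.restrict I) (by positivity) hr1
      (e (m + n) y) (hh (m + n)).measurable
      (by simpa using volume_ne_zero_of_mem_gen hI) (by simpa using volume_ne_top_of_mem_gen hI)
      (by
        rw [Measure.restrict_apply_univ]
        exact (cellAvg_mul_volume _ hI hy).symm)
    rwa [Measure.restrict_apply_univ] at h2
  have hm1 : ∀ n : ℕ, Measurable fun x =>
      S n x ^ (q - 1) * e (m + n) x ^ (1 / q) + e (m + n) x := fun n => by
    have := (hae (m + n)).measurable
    have := hSm n
    fun_prop
  have hsum : ∀ n, ∫⁻ x in L.X, S n x ^ q ≤ 2 ^ q * ∫⁻ x in L.X, ∑ i ∈ Finset.range n,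
      (S i x ^ (q - 1) * e (m + i) x ^ (1 / q) + e (m + i) x) := by
    intro n
    rw [lintegral_finsetSum _ fun i _ => hm1 i]
    induction n with
    | zero => simp [hS, hq0]
    | succ n ih =>
      refine (lintegral_mono (hstep n)).trans ?_
      have hm2 := (hh (m + n)).measurable
      rw [lintegral_add_left ((hSm n).pow_const q), lintegral_const_mul _ (by
        have := hSm n
        fun_prop), lintegral_add_right _ hm2, Finset.sum_range_succ, mul_add,
        lintegral_add_right _ (hae (m + n)).measurable, lintegral_cellAvg]
      rw [mul_add, mul_add]
      exact add_le_add ih (add_le_add_left (mul_le_mul_right (hJensen n) _) _)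
  -- Use $S_i\le S_n$ in the first terms, and $e=(e^{1/q})^{q-1}e^{1/q}\le T_n^{q-1}e^{1/q}$ in the
  -- second.
  have hpt : ∀ n x, ∑ i ∈ Finset.range n, (S i x ^ (q - 1) * e (m + i) x ^ (1 / q) + e (m + i) x)
      ≤ S n x ^ (q - 1) * T n x + T n x ^ q := by
    intro n x
    rw [Finset.sum_add_distrib, ← ENNReal.rpow_sub_one_mul_self hq (T n x), hT]
    simp only [Finset.mul_sum]
    gcongr with i hi i hi
    · exact Finset.sum_le_sum_of_subset (Finset.range_mono (Finset.mem_range.1 hi).le)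
    · calc e (m + i) x = (e (m + i) x ^ (1 / q)) ^ (q - 1) * e (m + i) x ^ (1 / q) := by
            rw [ENNReal.rpow_sub_one_mul_self hq, ENNReal.rpow_one_div_rpow hq0.ne']
        _ ≤ _ := by
            gcongr
            exact Finset.single_le_sum (f := fun i : ℕ => e (m + i) x ^ (1 / q))
              (fun _ _ => zero_le) hi
  have h2q0 : (2 : ℝ≥0∞) * 2 ^ q ≠ 0 := by
    have : (0 : ℝ≥0∞) < 2 ^ q := ENNReal.rpow_pos (by norm_num) (by norm_num)
    simp [this.ne']
  have h2qt : (2 : ℝ≥0∞) ^ q ≠ ∞ := ENNReal.rpow_ne_top_of_nonneg hq0.le (by norm_num)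
  have h2qt' : (2 : ℝ≥0∞) * 2 ^ q ≠ ∞ := ENNReal.mul_ne_top (by norm_num) h2qt
  -- The parameter $(2\cdot2^q)^{-1}$ is chosen so that the outer factor $2^q$ leaves exactly one
  -- half of $\int S_n^q$.
  have hpt2 : ∀ x, S n x ^ (q - 1) * T n x + T n x ^ q
      ≤ (2 * 2 ^ q)⁻¹ * S n x ^ q + ((2 * 2 ^ q) ^ (q - 1) + 1) * T n x ^ q := by
    intro x
    have := ENNReal.rpow_sub_one_mul_le hq (ENNReal.inv_ne_zero.2 h2qt')
      (ENNReal.inv_ne_top.2 h2q0) (S n x) (T n x)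
    rw [inv_inv] at this
    rw [add_mul, one_mul, ← add_assoc]
    gcongr
  have hfinal : ∫⁻ x in L.X, S n x ^ q ≤ 2⁻¹ * (∫⁻ x in L.X, S n x ^ q) +
      2 ^ q * ((2 * 2 ^ q) ^ (q - 1) + 1) * ∫⁻ x in L.X, T n x ^ q := by
    calc _ ≤ _ := hsum n
      _ ≤ 2 ^ q * ∫⁻ x in L.X, ((2 * 2 ^ q)⁻¹ * S n x ^ q
            + ((2 * 2 ^ q) ^ (q - 1) + 1) * T n x ^ q) := by
          gcongr with x
          exact (hpt n x).trans (hpt2 x)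
      _ = _ := by
          rw [lintegral_add_left (((hSm n).pow_const q).const_mul _),
            lintegral_const_mul _ ((hSm n).pow_const q),
            lintegral_const_mul _ ((hTm n).pow_const q), mul_add, ← mul_assoc, ← mul_assoc]
          congr 2
          rw [ENNReal.mul_inv (Or.inl (by norm_num)) (Or.inl (by norm_num)), mul_left_comm,
            ENNReal.mul_inv_cancel (right_ne_zero_of_mul h2q0) h2qt, mul_one]
  set A := ∫⁻ x in L.X, S n x ^ q
  have h2 : 2⁻¹ * A + 2⁻¹ * A = A := by rw [← add_mul, ENNReal.inv_two_add_inv_two, one_mul]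
  have h3 : 2⁻¹ * A ≤ 2 ^ q * ((2 * 2 ^ q) ^ (q - 1) + 1) * ∫⁻ x in L.X, T n x ^ q := by
    rw [← ENNReal.add_le_add_iff_left (ENNReal.mul_ne_top (by norm_num) hfin : 2⁻¹ * A ≠ ∞), h2]
    exact hfinal
  calc A = 2 * (2⁻¹ * A) := by
        rw [← mul_assoc, ENNReal.mul_inv_cancel (by norm_num) (by norm_num), one_mul]
    _ ≤ _ := by
        rw [mul_assoc]
        gcongr

theorem lintegral_tsum_rpow_le_cellAvg {q : ℝ} (hq : 1 ≤ q) {h : ℤ → ℝ → ℝ≥0∞}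
    (hh : ∀ k, L.Adapted (k + 1) (h k))
    (hfin : ∫⁻ x in L.X, (∑' k, h k x ^ (1 / q)) ^ q ≠ ∞) :
    ∫⁻ x in L.X, (∑' k, h k x ^ (1 / q)) ^ q
      ≤ 2 * (2 ^ q * ((2 * 2 ^ q) ^ (q - 1) + 1)) *
        ∫⁻ x in L.X, (∑' k, L.cellAvg k (h k) x ^ (1 / q)) ^ q := by
  have hq0 : 0 < q := by positivity
  refine lintegral_tsum_rpow_le (fun k => (hh k).measurable.pow_const _) hq0 fun m n =>
    (lintegral_sum_rpow_le_cellAvg hq hh m n (ne_top_of_le_ne_top hfin ?_)).trans ?_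
  · gcongr with x
    exact sum_range_add_le_tsum (fun k => h k x ^ (1 / q)) m n
  · gcongr with x
    exact sum_range_add_le_tsum (fun k => L.cellAvg k (h k) x ^ (1 / q)) m n

end IntervalLattice

/-! ### Comparison of the two square functions -/

namespace IntervalLattice

variable {L : IntervalLattice} {𝕜 : Type*} [RCLike 𝕜] (f : ℝ → 𝕜)

/-- Writing $|\Delta|^2$ as $(|\Delta|^p)^{2/p}$ brings the integral to the form of the general
inequalities with $h_k=|\Delta_{k+1}f|^p$. -/
theorem lintegral_squareFunction_rpow {p : ℝ} (hp : 0 < p) :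
    ∫⁻ x in L.X, L.squareFunction f x ^ p
      = ∫⁻ x in L.X, (∑' k, (‖L.genDiff (k + 1) f x‖ₑ ^ p) ^ (2 / p)) ^ (p / 2) := by
  refine setLIntegral_congr_fun measurableSet_X fun x hx => ?_
  rw [squareFunction_eq f hx, ← ENNReal.rpow_mul, one_div_mul_eq_div]
  congr 2
  funext k
  rw [← ENNReal.rpow_mul, mul_div_cancel₀ _ hp.ne']

theorem lintegral_avgSquareFunction_rpow {p : ℝ} (hp : 0 < p) :
    ∫⁻ x in L.X, L.avgSquareFunction p f x ^ p
      = ∫⁻ x in L.X, (∑' k, L.cellAvg k (fun y => ‖L.genDiff (k + 1) f y‖ₑ ^ p) x ^ (2 / p))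
        ^ (p / 2) := by
  refine setLIntegral_congr_fun measurableSet_X fun x hx => ?_
  rw [avgSquareFunction_eq f hp hx, ← ENNReal.rpow_mul, one_div_mul_eq_div]

theorem lpNorm_avgSquareFunction_le {p : ℝ} (hp0 : 0 < p) (hp2 : p ≤ 2) :
    L.lpNorm p (L.avgSquareFunction p f) ≤ 2 ^ (1 / p) * L.lpNorm p (L.squareFunction f) := by
  have hp' : (0 : ℝ) ≤ 1 / p := by positivity
  have hr : 1 ≤ 2 / p := by rwa [one_le_div hp0]
  rw [lpNorm_eq hp0, lpNorm_eq hp0, ← ENNReal.mul_rpow_of_nonneg _ _ hp']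
  refine ENNReal.rpow_le_rpow ?_ hp'
  rw [lintegral_squareFunction_rpow f hp0, lintegral_avgSquareFunction_rpow f hp0]
  have := lintegral_tsum_cellAvg_le (L := L) hr
    (h := fun k y => ‖L.genDiff (k + 1) f y‖ₑ ^ p)
    fun k => (adapted_genDiff f (k + 1)).comp fun a => ‖a‖ₑ ^ p
  rwa [one_div_div] at this

theorem lpNorm_squareFunction_le {p : ℝ} (hp : 2 ≤ p)
    (hf : L.lpNorm p (L.extSquareFunction f) < ∞) :
    L.lpNorm p (L.squareFunction f)
      ≤ (2 * (2 ^ (p / 2) * ((2 * 2 ^ (p / 2)) ^ (p / 2 - 1) + 1))) ^ (1 / p) *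
        L.lpNorm p (L.avgSquareFunction p f) := by
  have hp0 : 0 < p := by positivity
  have hp' : (0 : ℝ) ≤ 1 / p := by positivity
  have hq : 1 ≤ p / 2 := by rwa [one_le_div two_pos]
  -- Membership in $H^p$ supplies the a priori finiteness through the pointwise bound by the
  -- extended square function.
  have hfin : ∫⁻ x in L.X, L.squareFunction f x ^ p ≠ ∞ := by
    rw [lpNorm_eq hp0, ENNReal.rpow_lt_top_iff_of_pos (by positivity)] at hf
    refine ne_top_of_le_ne_top hf.ne (setLIntegral_mono' measurableSet_X fun x hx => ?_)
    exact ENNReal.rpow_le_rpow (squareFunction_le_extSquareFunction f hx) hp0.le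
  rw [lpNorm_eq hp0, lpNorm_eq hp0, ← ENNReal.mul_rpow_of_nonneg _ _ hp']
  refine ENNReal.rpow_le_rpow ?_ hp'
  rw [lintegral_squareFunction_rpow f hp0] at hfin
  rw [lintegral_squareFunction_rpow f hp0, lintegral_avgSquareFunction_rpow f hp0]
  have := lintegral_tsum_rpow_le_cellAvg (L := L) hq
    (h := fun k y => ‖L.genDiff (k + 1) f y‖ₑ ^ p)
    (fun k => (adapted_genDiff f (k + 1)).comp fun a => ‖a‖ₑ ^ p)
  rw [one_div_div] at this
  exact this hfin

theorem exists_lpNorm_avgSquareFunction_le (𝕜 : Type*) [RCLike 𝕜] {p : ℝ} (hp1 : 1 ≤ p)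
    (hp2 : p ≤ 2) : ∃ C : ℝ≥0, ∀ (L : IntervalLattice) (f : ℝ → 𝕜),
      L.lpNorm p (L.avgSquareFunction p f) ≤ C * L.lpNorm p (L.squareFunction f) := by
  have hp0 : 0 < p := by positivity
  lift (2 : ℝ≥0∞) ^ (1 / p) to ℝ≥0 using
    ENNReal.rpow_ne_top_of_nonneg (by positivity) (by norm_num) with C hC
  exact ⟨C, fun L f => hC ▸ lpNorm_avgSquareFunction_le f hp0 hp2⟩

theorem exists_lpNorm_squareFunction_le (𝕜 : Type*) [RCLike 𝕜] {p : ℝ} (hp : 2 ≤ p) :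
    ∃ C : ℝ≥0, ∀ (L : IntervalLattice) (f : ℝ → 𝕜), L.MemHardy p f →
      L.lpNorm p (L.squareFunction f) ≤ C * L.lpNorm p (L.avgSquareFunction p f) := by
  have hp0 : 0 < p := by positivity
  have h2 : (2 : ℝ≥0∞) ^ (p / 2) ≠ ∞ :=
    ENNReal.rpow_ne_top_of_nonneg (by positivity) (by norm_num)
  have hC : ((2 : ℝ≥0∞) * (2 ^ (p / 2) * ((2 * 2 ^ (p / 2)) ^ (p / 2 - 1) + 1))) ^ (1 / p) ≠ ∞ :=
    ENNReal.rpow_ne_top_of_nonneg (by positivity) <| ENNReal.mul_ne_top (by norm_num) <|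
      ENNReal.mul_ne_top h2 <| ENNReal.add_ne_top.2 ⟨ENNReal.rpow_ne_top_of_nonneg (by linarith) <|
        ENNReal.mul_ne_top (by norm_num) h2, by norm_num⟩
  obtain ⟨C, hC⟩ := WithTop.ne_top_iff_exists.1 hC
  exact ⟨C, fun L f hf => (lpNorm_squareFunction_le f hp hf.extSquareFunction_lt_top).trans_eq
    (congrArg (· * _) hC.symm)⟩

end IntervalLattice

/-! ### A lattice of nested cores -/

namespace NestedLattice

/-- The amount by which the core of generation `n` is shorter, at each end, than `[j, j + 1)`. -/
noncomputable def offset (n : ℕ) : ℝ := (1 - (1 / 2) ^ n) / 4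

/-- The core of generation `n` in `[j, j + 1)`. -/
def core (j n : ℕ) : Set ℝ := Ico (j + offset n) (j + 1 - offset n)

/-- The interval removed at the left from the core of generation `n`. -/
def leftPiece (j n : ℕ) : Set ℝ := Ico (j + offset n) (j + offset (n + 1))

/-- The interval removed at the right from the core of generation `n`. -/
def rightPiece (j n : ℕ) : Set ℝ := Ico (j + 1 - offset (n + 1)) (j + 1 - offset n)

/-- The intervals of generation `n`. -/
def level (n : ℕ) : Set (Set ℝ) :=
  {I | ∃ j, I = core j n ∨ ∃ i < n, I = leftPiece j i ∨ I = rightPiece j i}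

variable {i j k l n m : ℕ} {x : ℝ} {I J : Set ℝ}

theorem offset_zero : offset 0 = 0 := by simp [offset]

theorem offset_succ (n : ℕ) : offset (n + 1) = offset n + (1 / 2) ^ n / 8 := by
  rw [offset, offset, pow_succ]
  ring

theorem offset_strictMono : StrictMono offset := by
  refine strictMono_nat_of_lt_succ fun n => ?_
  rw [offset_succ]
  have : (0 : ℝ) < (1 / 2) ^ n / 8 := by positivity
  linarith

theorem offset_nonneg (n : ℕ) : 0 ≤ offset n := by
  rw [← offset_zero]
  exact offset_strictMono.monotone n.zero_le

theorem offset_lt (n : ℕ) : offset n < 1 / 4 := by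
  have : (0 : ℝ) < (1 / 2) ^ n := by positivity
  rw [offset]
  linarith

theorem core_antitone (j : ℕ) : Antitone (core j) := fun m n hmn =>
  Ico_subset_Ico (by linarith [offset_strictMono.monotone hmn])
    (by linarith [offset_strictMono.monotone hmn])

theorem core_eq_union (j n : ℕ) :
    core j n = leftPiece j n ∪ core j (n + 1) ∪ rightPiece j n := by
  have h1 := offset_strictMono (Nat.lt_succ_self n)
  have h2 := offset_lt (n + 1)
  have h3 : (j : ℝ) + offset (n + 1) ≤ j + 1 - offset (n + 1) := by linarith
  rw [core, leftPiece, core, rightPiece, Ico_union_Ico_eq_Ico (by linarith) h3,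
    Ico_union_Ico_eq_Ico (by linarith) (by linarith)]

theorem leftPiece_subset (j n : ℕ) : leftPiece j n ⊆ core j n := by
  rw [core_eq_union, union_assoc]
  exact subset_union_left

theorem rightPiece_subset (j n : ℕ) : rightPiece j n ⊆ core j n := by
  rw [core_eq_union]
  exact subset_union_right

theorem disjoint_leftPiece_core (j n : ℕ) : Disjoint (leftPiece j n) (core j (n + 1)) :=
  Ico_disjoint_Ico.2 (by simp)

theorem disjoint_rightPiece_core (j n : ℕ) : Disjoint (rightPiece j n) (core j (n + 1)) :=
  Ico_disjoint_Ico.2 (by simp)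

theorem disjoint_leftPiece_rightPiece (j n : ℕ) : Disjoint (leftPiece j n) (rightPiece j n) := by
  have := offset_lt (n + 1)
  refine Ico_disjoint_Ico.2 (le_trans (min_le_left _ _) (le_trans ?_ (le_max_right _ _)))
  linarith

theorem core_diff_core (j n : ℕ) :
    core j n \ core j (n + 1) = leftPiece j n ∪ rightPiece j n := by
  rw [core_eq_union, union_right_comm, union_sdiff_right, sdiff_eq_left, disjoint_union_left]
  exact ⟨disjoint_leftPiece_core j n, disjoint_rightPiece_core j n⟩

theorem core_zero (j : ℕ) : core j 0 = Ico (j : ℝ) (j + 1) := by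
  rw [core, offset_zero, add_zero, sub_zero]

theorem mem_core_zero_iff : x ∈ core j 0 ↔ 0 ≤ x ∧ ⌊x⌋₊ = j := by
  rw [core_zero, mem_Ico]
  constructor
  · rintro ⟨h1, h2⟩
    have h0 : 0 ≤ x := (Nat.cast_nonneg j).trans h1
    exact ⟨h0, (Nat.floor_eq_iff h0).2 ⟨h1, h2⟩⟩
  · rintro ⟨h0, h⟩
    exact (Nat.floor_eq_iff h0).1 h

theorem floor_eq_of_mem_core (hx : x ∈ core j n) : ⌊x⌋₊ = j :=
  (mem_core_zero_iff.1 (core_antitone j n.zero_le hx)).2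

theorem mem_core_floor_zero (hx : 0 ≤ x) : x ∈ core ⌊x⌋₊ 0 := mem_core_zero_iff.2 ⟨hx, rfl⟩

/-- The differences of consecutive cores are pairwise disjoint. -/
theorem eq_of_mem_diff (h : x ∈ core j i \ core j (i + 1)) (h' : x ∈ core l k \ core l (k + 1)) :
    j = l ∧ i = k := by
  have hjl : j = l := (floor_eq_of_mem_core h.1).symm.trans (floor_eq_of_mem_core h'.1)
  subst hjl
  refine ⟨rfl, ?_⟩
  rcases lt_trichotomy i k with hik | hik | hik
  · exact (h.2 (core_antitone j (Nat.succ_le_of_lt hik) h'.1)).elim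
  · exact hik
  · exact (h'.2 (core_antitone j (Nat.succ_le_of_lt hik) h.1)).elim

theorem leftPiece_subset_diff (j i : ℕ) : leftPiece j i ⊆ core j i \ core j (i + 1) := by
  rw [core_diff_core]
  exact subset_union_left

theorem rightPiece_subset_diff (j i : ℕ) : rightPiece j i ⊆ core j i \ core j (i + 1) := by
  rw [core_diff_core]
  exact subset_union_right

theorem mem_core_or_mem_diff (hx : x ∈ core j 0) (n : ℕ) :
    x ∈ core j n ∨ ∃ i < n, x ∈ core j i \ core j (i + 1) := by
  induction n with
  | zero => exact Or.inl hx
  | succ n ih =>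
    rcases ih with h | ⟨i, hi, h⟩
    · by_cases h' : x ∈ core j (n + 1)
      · exact Or.inl h'
      · exact Or.inr ⟨n, n.lt_succ_self, h, h'⟩
    · exact Or.inr ⟨i, hi.trans n.lt_succ_self, h⟩

theorem core_mem_level (j n : ℕ) : core j n ∈ level n := ⟨j, Or.inl rfl⟩

theorem leftPiece_mem_level (j : ℕ) (h : i < n) : leftPiece j i ∈ level n :=
  ⟨j, Or.inr ⟨i, h, Or.inl rfl⟩⟩

theorem rightPiece_mem_level (j : ℕ) (h : i < n) : rightPiece j i ∈ level n :=
  ⟨j, Or.inr ⟨i, h, Or.inr rfl⟩⟩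

theorem exists_Ico_of_mem_level (hI : I ∈ level n) : ∃ a b : ℝ, a < b ∧ I = Ico a b := by
  obtain ⟨j, rfl | ⟨i, -, rfl | rfl⟩⟩ := hI
  · exact ⟨_, _, by linarith [offset_lt n], rfl⟩
  · exact ⟨_, _, by linarith [offset_strictMono i.lt_succ_self], rfl⟩
  · exact ⟨_, _, by linarith [offset_strictMono i.lt_succ_self], rfl⟩

theorem eq_of_mem_level (hI : I ∈ level n) (hJ : J ∈ level n) (hxI : x ∈ I) (hxJ : x ∈ J) :
    I = J := by
  have hcore : ∀ {j i l : ℕ}, i < n → x ∈ core j i \ core j (i + 1) → x ∉ core l n := by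
    intro j i l hi hx hx'
    have : j = l := (floor_eq_of_mem_core hx.1).symm.trans (floor_eq_of_mem_core hx')
    subst this
    exact hx.2 (core_antitone j (Nat.succ_le_of_lt hi) hx')
  obtain ⟨j, rfl | ⟨i, hi, rfl | rfl⟩⟩ := hI <;> obtain ⟨l, rfl | ⟨k, hk, rfl | rfl⟩⟩ := hJ
  · rw [← floor_eq_of_mem_core hxI, ← floor_eq_of_mem_core hxJ]
  · exact (hcore hk (leftPiece_subset_diff l k hxJ) hxI).elim
  · exact (hcore hk (rightPiece_subset_diff l k hxJ) hxI).elim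
  · exact (hcore hi (leftPiece_subset_diff j i hxI) hxJ).elim
  · obtain ⟨rfl, rfl⟩ := eq_of_mem_diff (leftPiece_subset_diff j i hxI)
      (leftPiece_subset_diff l k hxJ)
    rfl
  · obtain ⟨rfl, rfl⟩ := eq_of_mem_diff (leftPiece_subset_diff j i hxI)
      (rightPiece_subset_diff l k hxJ)
    exact (Set.disjoint_left.1 (disjoint_leftPiece_rightPiece j i) hxI hxJ).elim
  · exact (hcore hi (rightPiece_subset_diff j i hxI) hxJ).elim
  · obtain ⟨rfl, rfl⟩ := eq_of_mem_diff (rightPiece_subset_diff j i hxI)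
      (leftPiece_subset_diff l k hxJ)
    exact (Set.disjoint_left.1 (disjoint_leftPiece_rightPiece j i) hxJ hxI).elim
  · obtain ⟨rfl, rfl⟩ := eq_of_mem_diff (rightPiece_subset_diff j i hxI)
      (rightPiece_subset_diff l k hxJ)
    rfl

theorem sUnion_level (n : ℕ) : ⋃₀ level n = Ici 0 := by
  refine Subset.antisymm (sUnion_subset ?_) fun x hx => ?_
  · have h : ∀ j i, core j i ⊆ Ici (0 : ℝ) := fun j i x hx =>
      (mem_core_zero_iff.1 (core_antitone j i.zero_le hx)).1
    rintro I ⟨j, rfl | ⟨i, -, rfl | rfl⟩⟩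
    · exact h j n
    · exact (leftPiece_subset j i).trans (h j i)
    · exact (rightPiece_subset j i).trans (h j i)
  · rcases mem_core_or_mem_diff (mem_core_floor_zero hx) n with h | ⟨i, hi, h⟩
    · exact ⟨_, core_mem_level _ n, h⟩
    · rw [core_diff_core] at h
      rcases h with h | h
      · exact ⟨_, leftPiece_mem_level _ hi, h⟩
      · exact ⟨_, rightPiece_mem_level _ hi, h⟩

theorem subset_level_singleton (hI : I ∈ level n) : {J | J ∈ level n ∧ J ⊆ I} = {I} := by
  ext J
  constructor
  · rintro ⟨hJ, hJI⟩
    obtain ⟨a, b, hab, rfl⟩ := exists_Ico_of_mem_level hJ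
    exact eq_of_mem_level hJ hI (left_mem_Ico.2 hab) (hJI (left_mem_Ico.2 hab))
  · rintro rfl
    exact ⟨hI, Subset.rfl⟩

/-- The case `m = n` is needed because consecutive negative generations of the lattice coincide. -/
theorem refinement_level (hI : I ∈ level n) (h : n ≤ m) (h' : m ≤ n + 1) :
    {J | J ∈ level m ∧ J ⊆ I}.Finite ∧ ⋃₀ {J | J ∈ level m ∧ J ⊆ I} = I := by
  have hsame : I ∈ level m →
      {J | J ∈ level m ∧ J ⊆ I}.Finite ∧ ⋃₀ {J | J ∈ level m ∧ J ⊆ I} = I := fun hI' => by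
    rw [subset_level_singleton hI']
    exact ⟨finite_singleton I, sUnion_singleton I⟩
  rcases h.eq_or_lt with rfl | hlt
  · exact hsame hI
  obtain rfl : m = n + 1 := le_antisymm h' hlt
  obtain ⟨j, rfl | ⟨i, hi, rfl | rfl⟩⟩ := hI
  · have heq : {J | J ∈ level (n + 1) ∧ J ⊆ core j n}
        = {leftPiece j n, core j (n + 1), rightPiece j n} := by
      ext J
      constructor
      · rintro ⟨hJ, hJs⟩
        obtain ⟨a, b, hab, rfl⟩ := exists_Ico_of_mem_level hJ
        have ha := left_mem_Ico.2 hab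
        have hac := hJs ha
        rw [core_eq_union] at hac
        rcases hac with (h | h) | h
        · exact Or.inl (eq_of_mem_level hJ (leftPiece_mem_level j n.lt_succ_self) ha h)
        · exact Or.inr (Or.inl (eq_of_mem_level hJ (core_mem_level j (n + 1)) ha h))
        · exact Or.inr (Or.inr (eq_of_mem_level hJ (rightPiece_mem_level j n.lt_succ_self) ha h))
      · rintro (rfl | rfl | rfl)
        · exact ⟨leftPiece_mem_level j n.lt_succ_self, leftPiece_subset j n⟩
        · exact ⟨core_mem_level j (n + 1), core_antitone j n.le_succ⟩
        · exact ⟨rightPiece_mem_level j n.lt_succ_self, rightPiece_subset j n⟩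
    rw [heq]
    refine ⟨by simp, ?_⟩
    rw [sUnion_insert, sUnion_insert, sUnion_singleton, ← union_assoc, ← core_eq_union]
  · exact hsame (leftPiece_mem_level j (hi.trans n.lt_succ_self))
  · exact hsame (rightPiece_mem_level j (hi.trans n.lt_succ_self))

end NestedLattice

open NestedLattice in
/-- The lattice on `[0, ∞)` in which, at every step, the core of each `[j, j + 1)` is divided into
a smaller core and two intervals of equal length at its ends. -/
def nestedLattice : IntervalLattice where
  X := Ici 0
  ordConnected := ordConnected_Ici
  -- All generations `k ≤ 0` consist of the unit intervals `[j, j + 1)`, which are therefore the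
  -- maximal intervals.
  gen k := level k.toNat
  isIco _ _ hI := exists_Ico_of_mem_level hI
  disjoint k I hI J hJ hIJ := by
    rw [Function.onFun, id, id, Set.disjoint_left]
    exact fun x hxI hxJ => hIJ (eq_of_mem_level hI hJ hxI hxJ)
  cover k := sUnion_level k.toNat
  refinement k I hI := refinement_level hI (by omega) (by omega)

namespace NestedLattice

variable {i j k l n m : ℕ} {x : ℝ} {I J : Set ℝ}

/-! ### Step functions on the nested lattice -/

variable (𝕜 : Type*) [RCLike 𝕜]

/-- The function that takes the value `c j i` on `leftPiece j i`, the value `-c j i` on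
`rightPiece j i`, and vanishes elsewhere. -/
noncomputable def step (c : ℕ → ℕ → ℝ) (x : ℝ) : 𝕜 :=
  ∑ᶠ i, ((leftPiece ⌊x⌋₊ i).indicator (fun _ => (c ⌊x⌋₊ i : 𝕜)) x
    - (rightPiece ⌊x⌋₊ i).indicator (fun _ => (c ⌊x⌋₊ i : 𝕜)) x)

variable (c : ℕ → ℕ → ℝ)

theorem step_of_mem_diff (hx : x ∈ core j i \ core j (i + 1)) :
    step 𝕜 c x = (leftPiece j i).indicator (fun _ => (c j i : 𝕜)) x
      - (rightPiece j i).indicator (fun _ => (c j i : 𝕜)) x := by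
  have hj : ⌊x⌋₊ = j := floor_eq_of_mem_core hx.1
  rw [step, hj, finsum_eq_single _ i]
  intro k hk
  rw [indicator_of_notMem, indicator_of_notMem, sub_zero]
  · exact fun h => hk (eq_of_mem_diff (rightPiece_subset_diff j k h) hx).2
  · exact fun h => hk (eq_of_mem_diff (leftPiece_subset_diff j k h) hx).2

theorem step_of_mem_leftPiece (hx : x ∈ leftPiece j i) : step 𝕜 c x = c j i := by
  rw [step_of_mem_diff 𝕜 c (leftPiece_subset_diff j i hx), indicator_of_mem hx,
    indicator_of_notMem, sub_zero]
  exact Set.disjoint_left.1 (disjoint_leftPiece_rightPiece j i) hx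

theorem step_of_mem_rightPiece (hx : x ∈ rightPiece j i) : step 𝕜 c x = -c j i := by
  rw [step_of_mem_diff 𝕜 c (rightPiece_subset_diff j i hx), indicator_of_mem hx,
    indicator_of_notMem, zero_sub]
  exact Set.disjoint_right.1 (disjoint_leftPiece_rightPiece j i) hx

theorem step_eq_zero (hx : ∀ j i, x ∉ core j i \ core j (i + 1)) : step 𝕜 c x = 0 := by
  rw [step]
  refine (finsum_congr fun i => ?_).trans finsum_zero
  rw [indicator_of_notMem, indicator_of_notMem, sub_zero]
  · exact fun h => hx _ i (rightPiece_subset_diff _ i h)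
  · exact fun h => hx _ i (leftPiece_subset_diff _ i h)

theorem norm_step_of_mem_diff (hx : x ∈ core j i \ core j (i + 1)) : ‖step 𝕜 c x‖ = |c j i| := by
  rw [core_diff_core] at hx
  rcases hx with hx | hx
  · rw [step_of_mem_leftPiece 𝕜 c hx, RCLike.norm_ofReal]
  · rw [step_of_mem_rightPiece 𝕜 c hx, norm_neg, RCLike.norm_ofReal]

theorem enorm_step_of_mem_diff (hx : x ∈ core j i \ core j (i + 1)) :
    ‖step 𝕜 c x‖ₑ = ‖c j i‖ₑ := by
  rw [enorm_eq_iff_norm_eq, norm_step_of_mem_diff 𝕜 c hx, Real.norm_eq_abs]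

theorem step_of_notMem_X (hx : x ∉ nestedLattice.X) : step 𝕜 c x = 0 :=
  step_eq_zero 𝕜 c fun _ i h => hx (mem_core_zero_iff.1 (core_antitone _ i.zero_le h.1)).1

/-- Countably many pieces carry constant values, and the function vanishes on the complement of
their union. This complement is measurable although no interval of the lattice lies inside it. -/
theorem measurable_step : Measurable[nestedLattice.sigmaAlgebra] (step 𝕜 c) := by
  intro s _
  have hpiece : ∀ j i, MeasurableSet[nestedLattice.sigmaAlgebra] (leftPiece j i) ∧
      MeasurableSet[nestedLattice.sigmaAlgebra] (rightPiece j i) := fun j i =>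
    ⟨MeasurableSpace.measurableSet_generateFrom
      (mem_iUnion.2 ⟨(i + 1 : ℕ), leftPiece_mem_level j i.lt_succ_self⟩),
    MeasurableSpace.measurableSet_generateFrom
      (mem_iUnion.2 ⟨(i + 1 : ℕ), rightPiece_mem_level j i.lt_succ_self⟩)⟩
  have hinter : ∀ {P : Set ℝ} {a : 𝕜}, MeasurableSet[nestedLattice.sigmaAlgebra] P →
      (∀ x ∈ P, step 𝕜 c x = a) →
      MeasurableSet[nestedLattice.sigmaAlgebra] (P ∩ step 𝕜 c ⁻¹' s) := by
    intro P a hP ha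
    by_cases has : a ∈ s
    · rwa [inter_eq_left.2]
      intro x hx
      rwa [mem_preimage, ha x hx]
    · have hdisj : Disjoint P (step 𝕜 c ⁻¹' s) :=
        Set.disjoint_left.2 fun x hx hxs => has (ha x hx ▸ hxs)
      rw [hdisj.inter_eq]
      exact @MeasurableSet.empty _ nestedLattice.sigmaAlgebra
  set P : ℕ → ℕ → Set ℝ := fun j i => core j i \ core j (i + 1)
  have hP : ∀ j i, MeasurableSet[nestedLattice.sigmaAlgebra] (P j i) := fun j i => by
    simp only [P, core_diff_core]
    exact (hpiece j i).1.union (hpiece j i).2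
  have hU : MeasurableSet[nestedLattice.sigmaAlgebra] (⋃ j, ⋃ i, P j i) :=
    MeasurableSet.iUnion fun j => MeasurableSet.iUnion fun i => hP j i
  have h1 : step 𝕜 c ⁻¹' s = (⋃ j, ⋃ i, (leftPiece j i ∩ step 𝕜 c ⁻¹' s) ∪
      (rightPiece j i ∩ step 𝕜 c ⁻¹' s)) ∪ ((⋃ j, ⋃ i, P j i)ᶜ ∩ step 𝕜 c ⁻¹' s) := by
    simp only [← union_inter_distrib_right, ← core_diff_core, ← iUnion_inter]
    change _ = ((⋃ j, ⋃ i, P j i) ∪ _) ∩ _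
    rw [union_compl_self, univ_inter]
  rw [h1]
  refine MeasurableSet.union (MeasurableSet.iUnion fun j => MeasurableSet.iUnion fun i =>
    MeasurableSet.union (hinter (hpiece j i).1 fun x hx => step_of_mem_leftPiece 𝕜 c hx)
      (hinter (hpiece j i).2 fun x hx => step_of_mem_rightPiece 𝕜 c hx)) ?_
  refine hinter hU.compl (a := 0) fun x hx => step_eq_zero 𝕜 c fun j i h => hx ?_
  exact mem_iUnion₂.2 ⟨j, i, h⟩

theorem measurable_step_borel : Measurable (step 𝕜 c) := by
  refine (measurable_step 𝕜 c).mono (MeasurableSpace.generateFrom_le fun I hI => ?_) le_rfl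
  obtain ⟨k, hk⟩ := mem_iUnion.1 hI
  exact IntervalLattice.measurableSet_of_mem_gen hk

theorem measurableSet_core (j n : ℕ) : MeasurableSet (core j n) := measurableSet_Ico

theorem measurableSet_leftPiece (j n : ℕ) : MeasurableSet (leftPiece j n) := measurableSet_Ico

theorem measurableSet_rightPiece (j n : ℕ) : MeasurableSet (rightPiece j n) := measurableSet_Ico

theorem pairwise_disjoint_core (n : ℕ) : Pairwise (Function.onFun Disjoint fun j => core j n) := by
  intro j l hjl
  rw [Function.onFun, Set.disjoint_left]
  exact fun x hx hx' => hjl ((floor_eq_of_mem_core hx).symm.trans (floor_eq_of_mem_core hx'))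

theorem iUnion_core_zero : ⋃ j, core j 0 = Ici 0 := by
  ext x
  rw [mem_iUnion]
  exact ⟨fun ⟨_, h⟩ => (mem_core_zero_iff.1 h).1, fun h => ⟨_, mem_core_floor_zero h⟩⟩

theorem lintegral_X_eq_tsum_core (g : ℝ → ℝ≥0∞) :
    ∫⁻ x in nestedLattice.X, g x = ∑' j, ∫⁻ x in core j 0, g x := by
  change ∫⁻ x in Ici 0, g x = _
  rw [← iUnion_core_zero, lintegral_iUnion (fun j => measurableSet_core j 0)
    (pairwise_disjoint_core 0)]

/-! The remaining results concern coefficients that vanish on all but finitely many intervals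
inside each `[j, j + 1)`. -/

variable {c} {N : ℕ → ℕ} (hc : ∀ j, ∀ i ≥ N j, c j i = 0)

include hc

theorem step_eq_zero_of_mem_core (hx : x ∈ core j (N j)) : step 𝕜 c x = 0 := by
  by_cases h : ∃ l i, x ∈ core l i \ core l (i + 1)
  · obtain ⟨l, i, h⟩ := h
    have hl : l = j := (floor_eq_of_mem_core h.1).symm.trans (floor_eq_of_mem_core hx)
    subst hl
    rw [← norm_eq_zero, norm_step_of_mem_diff 𝕜 c h, hc l i, abs_zero]
    by_contra! hi
    exact h.2 (core_antitone l (Nat.succ_le_of_lt hi) hx)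
  · push Not at h
    exact step_eq_zero 𝕜 c h

theorem norm_step_le (hx : x ∈ core j 0) : ‖step 𝕜 c x‖ ≤ ∑ i ∈ Finset.range (N j), |c j i| := by
  rcases mem_core_or_mem_diff hx (N j) with h | ⟨i, hi, h⟩
  · rw [step_eq_zero_of_mem_core 𝕜 hc h, norm_zero]
    positivity
  · rw [norm_step_of_mem_diff 𝕜 c h]
    exact Finset.single_le_sum (f := fun i => |c j i|) (fun _ _ => abs_nonneg _)
      (Finset.mem_range.2 hi)

theorem integrableOn_step_core (j : ℕ) : IntegrableOn (step 𝕜 c) (core j 0) :=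
  Measure.integrableOn_of_bounded (M := ∑ i ∈ Finset.range (N j), |c j i|)
    (by simp [core]) (measurable_step_borel 𝕜 c).aestronglyMeasurable
    ((ae_restrict_iff' (measurableSet_core j 0)).2 (ae_of_all _ fun _ hx => norm_step_le 𝕜 hc hx))

theorem integrableOn_step {I : Set ℝ} (hI : I ⊆ core j 0) : IntegrableOn (step 𝕜 c) I :=
  (integrableOn_step_core 𝕜 hc j).mono_set hI

theorem locallyIntegrableOn_step : LocallyIntegrableOn (step 𝕜 c) (Ici 0) := by
  intro x _
  obtain ⟨n, hn⟩ := exists_nat_gt x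
  refine ⟨Iio (n : ℝ) ∩ Ici 0, Filter.inter_mem (mem_nhdsWithin_of_mem_nhds (Iio_mem_nhds hn))
    self_mem_nhdsWithin, ?_⟩
  have : IntegrableOn (step 𝕜 c) (⋃ j ∈ Finset.range n, core j 0) := by
    rw [integrableOn_finset_iUnion]
    exact fun j _ => integrableOn_step_core 𝕜 hc j
  refine this.mono_set fun y hy => ?_
  simp only [mem_iUnion, Finset.mem_range]
  exact ⟨⌊y⌋₊, (Nat.floor_lt hy.2).2 hy.1, mem_core_floor_zero hy.2⟩

/-- The two end pieces have equal length and opposite values, so passing to the next core does not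
change the integral; on the core `N j` the function is zero. -/
theorem setIntegral_core_step (j n : ℕ) : ∫ x in core j n, step 𝕜 c x = 0 := by
  have hstep : ∀ n, ∫ x in core j n, step 𝕜 c x = ∫ x in core j (n + 1), step 𝕜 c x := by
    intro n
    have hsub : core j n ⊆ core j 0 := core_antitone j n.zero_le
    have hint : ∀ {I}, I ⊆ core j n → IntegrableOn (step 𝕜 c) I := fun hI =>
      integrableOn_step 𝕜 hc (hI.trans hsub)
    have hL : ∫ x in leftPiece j n, step 𝕜 c x = ((1 / 2) ^ n / 8 : ℝ) • (c j n : 𝕜) := by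
      rw [setIntegral_congr_fun (measurableSet_leftPiece j n) fun x hx =>
        step_of_mem_leftPiece 𝕜 c hx,
        setIntegral_const, leftPiece, Real.volume_real_Ico_of_le
          (by linarith [offset_strictMono n.lt_succ_self]), offset_succ]
      congr 1
      ring
    have hR : ∫ x in rightPiece j n, step 𝕜 c x = -(((1 / 2) ^ n / 8 : ℝ) • (c j n : 𝕜)) := by
      rw [setIntegral_congr_fun (measurableSet_rightPiece j n) fun x hx =>
        step_of_mem_rightPiece 𝕜 c hx,
        setIntegral_const, rightPiece, Real.volume_real_Ico_of_le
          (by linarith [offset_strictMono n.lt_succ_self]), offset_succ, ← smul_neg]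
      congr 1
      ring
    have h1 : Disjoint (leftPiece j n ∪ core j (n + 1)) (rightPiece j n) :=
      disjoint_union_left.2 ⟨disjoint_leftPiece_rightPiece j n, (disjoint_rightPiece_core j n).symm⟩
    rw [core_eq_union j n, setIntegral_union h1 measurableSet_Ico
      (hint (union_subset (leftPiece_subset j n) (core_antitone j n.le_succ)))
      (hint (rightPiece_subset j n)), setIntegral_union (disjoint_leftPiece_core j n)
      measurableSet_Ico (hint (leftPiece_subset j n)) (hint (core_antitone j n.le_succ)), hL, hR]
    ring
  have hadd : ∀ m, ∫ x in core j n, step 𝕜 c x = ∫ x in core j (n + m), step 𝕜 c x := by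
    intro m
    induction m with
    | zero => rfl
    | succ m ih => rw [ih, hstep, add_assoc]
  rw [hadd (N j)]
  refine setIntegral_eq_zero_of_forall_eq_zero fun x hx => ?_
  exact step_eq_zero_of_mem_core 𝕜 hc (core_antitone j (Nat.le_add_left _ _) hx)

theorem admissible_step : nestedLattice.Admissible (step 𝕜 c) where
  measurable := by
    convert measurable_step 𝕜 c using 1
    rw [indicator_eq_self]
    intro x hx
    by_contra h
    exact hx (step_of_notMem_X 𝕜 c h)
  locallyIntegrable := locallyIntegrableOn_step 𝕜 hc
  integrableOn I hI := by
    obtain ⟨k, j, rfl | ⟨i, -, rfl | rfl⟩⟩ := mem_iUnion.1 hI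
    · exact integrableOn_step 𝕜 hc (core_antitone j (Nat.zero_le _))
    · exact integrableOn_step 𝕜 hc ((leftPiece_subset j i).trans (core_antitone j i.zero_le))
    · exact integrableOn_step 𝕜 hc ((rightPiece_subset j i).trans (core_antitone j i.zero_le))

omit hc in
-- A chain is constant up to index 0 and decreasing afterwards, so its union is its member at index
-- 0.
theorem exists_eq_core_of_mem_topIntervals (hI : I ∈ nestedLattice.topIntervals) :
    ∃ j, I = core j 0 := by
  obtain ⟨d, hd, hanti, rfl⟩ := hI
  have hd' : ∀ k : ℤ, k ≤ 0 → ∃ j, d k = core j 0 := by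
    intro k hk
    have h : d k ∈ level k.toNat := hd k
    rw [Int.toNat_of_nonpos hk] at h
    obtain ⟨j, h | ⟨i, hi, -⟩⟩ := h
    · exact ⟨j, h⟩
    · exact (Nat.not_lt_zero i hi).elim
  have hmono : Antitone d := antitone_int_of_succ_le fun k => by
    have := hanti (k + 1)
    rwa [add_sub_cancel_right] at this
  obtain ⟨j, hj⟩ := hd' 0 le_rfl
  refine ⟨j, Subset.antisymm (iUnion_subset fun k => ?_) (hj ▸ subset_iUnion d 0)⟩
  rcases le_total k 0 with hk | hk
  · have h0 : d 0 ∈ level 0 := hd 0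
    have hk' : d k ∈ level 0 := by
      have h : d k ∈ level k.toNat := hd k
      rwa [Int.toNat_of_nonpos hk] at h
    obtain ⟨a, b, hab, hI⟩ := exists_Ico_of_mem_level h0
    have ha : a ∈ d 0 := hI ▸ left_mem_Ico.2 hab
    rw [eq_of_mem_level hk' h0 (hmono hk ha) ha, hj]
  · rw [← hj]
    exact hmono hk

theorem topMeanZero_step : nestedLattice.TopMeanZero (step 𝕜 c) := by
  rintro I ⟨hI, -⟩
  obtain ⟨j, rfl⟩ := exists_eq_core_of_mem_topIntervals hI
  exact ⟨integrableOn_step_core 𝕜 hc j, setIntegral_core_step 𝕜 hc j 0⟩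

theorem topDiff_step (x : ℝ) : nestedLattice.topDiff (step 𝕜 c) x = 0 := by
  rw [IntervalLattice.topDiff, finsum_mem_def]
  refine (finsum_congr fun I => ?_).trans finsum_zero
  by_cases hI : I ∈ nestedLattice.topIntervalsFin
  · rw [indicator_of_mem hI, intervalAvg, setAverage_eq, (topMeanZero_step 𝕜 hc I hI).2,
      smul_zero, indicator_zero]
  · exact indicator_of_notMem hI _

/-! ### The martingale differences of a step function -/

theorem condExp_step_of_mem_core {k : ℤ} (hx : x ∈ core j k.toNat) :
    nestedLattice.condExp k (step 𝕜 c) x = 0 := by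
  rw [IntervalLattice.condExp_eq _ (I := core j k.toNat) (core_mem_level j _) hx, setAverage_eq,
    setIntegral_core_step 𝕜 hc, smul_zero]

omit hc in
theorem condExp_step_of_mem_diff {k : ℤ} (hi : i < k.toNat)
    (hx : x ∈ core j i \ core j (i + 1)) :
    nestedLattice.condExp k (step 𝕜 c) x = step 𝕜 c x := by
  have hconst : ∀ {I : Set ℝ} {a : 𝕜}, I ∈ nestedLattice.gen k → x ∈ I →
      (∀ y ∈ I, step 𝕜 c y = a) → nestedLattice.condExp k (step 𝕜 c) x = step 𝕜 c x := by
    intro I a hI hxI ha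
    rw [IntervalLattice.condExp_eq _ hI hxI, ha x hxI,
      setAverage_congr_fun (IntervalLattice.measurableSet_of_mem_gen hI) (ae_of_all _ ha),
      setAverage_const (IntervalLattice.volume_ne_zero_of_mem_gen hI)
        (IntervalLattice.volume_ne_top_of_mem_gen hI)]
  rw [core_diff_core] at hx
  rcases hx with hx | hx
  · exact hconst (leftPiece_mem_level j hi) hx fun y hy => step_of_mem_leftPiece 𝕜 c hy
  · exact hconst (rightPiece_mem_level j hi) hx fun y hy => step_of_mem_rightPiece 𝕜 c hy

theorem genDiff_step_of_mem_core {k : ℤ} (hx : x ∈ core j (k + 1).toNat) :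
    nestedLattice.genDiff (k + 1) (step 𝕜 c) x = 0 := by
  rw [IntervalLattice.genDiff_succ, condExp_step_of_mem_core 𝕜 hc hx,
    condExp_step_of_mem_core 𝕜 hc (core_antitone j (by omega : k.toNat ≤ (k + 1).toNat) hx),
    sub_zero]

/-- The averages at `x` are 0 as long as `x` stays in the core, and equal the value of the function
once the piece around `x` has split off. The only jump is from generation `i` to `i + 1`. -/
theorem genDiff_step_of_mem_diff {k : ℤ} (hx : x ∈ core j i \ core j (i + 1)) :
    nestedLattice.genDiff (k + 1) (step 𝕜 c) x = if k = i then step 𝕜 c x else 0 := by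
  split_ifs with h
  · subst h
    rw [IntervalLattice.genDiff_succ, condExp_step_of_mem_diff 𝕜 (by omega) hx,
      condExp_step_of_mem_core 𝕜 hc (j := j) (by simpa using hx.1), sub_zero]
  · rcases lt_or_gt_of_ne h with h | h
    · exact genDiff_step_of_mem_core 𝕜 hc
        (core_antitone j (by omega : (k + 1).toNat ≤ i) hx.1)
    · rw [IntervalLattice.genDiff_succ, condExp_step_of_mem_diff 𝕜 (by omega) hx,
        condExp_step_of_mem_diff 𝕜 (by omega) hx, sub_self]

/-- At most one difference is nonzero at a given point, so the square function of `step` is just its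
absolute value. -/
theorem genDiff_step_sum (hx : x ∈ nestedLattice.X) :
    (∑' k, ‖nestedLattice.genDiff (k + 1) (step 𝕜 c) x‖ₑ ^ (2 : ℝ)) = ‖step 𝕜 c x‖ₑ ^ (2 : ℝ) := by
  by_cases h : ∃ l i, x ∈ core l i \ core l (i + 1)
  · obtain ⟨j, i, h⟩ := h
    rw [tsum_eq_single (i : ℤ)]
    · rw [genDiff_step_of_mem_diff 𝕜 hc h, if_pos rfl]
    · intro k hk
      rw [genDiff_step_of_mem_diff 𝕜 hc h, if_neg hk]
      simp
  · push Not at h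
    have hcore : ∀ n, x ∈ core ⌊x⌋₊ n := fun n => by
      rcases mem_core_or_mem_diff (mem_core_floor_zero hx) n with h' | ⟨i, -, h'⟩
      · exact h'
      · exact (h _ i h').elim
    rw [step_eq_zero 𝕜 c h]
    simp [fun k => genDiff_step_of_mem_core 𝕜 hc (k := k) (hcore _)]

theorem squareFunction_step (hx : x ∈ nestedLattice.X) :
    nestedLattice.squareFunction (step 𝕜 c) x = ‖step 𝕜 c x‖ₑ := by
  rw [IntervalLattice.squareFunction_eq _ hx, genDiff_step_sum 𝕜 hc hx,
    ENNReal.rpow_rpow_one_div two_ne_zero]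

theorem extSquareFunction_step (hx : x ∈ nestedLattice.X) :
    nestedLattice.extSquareFunction (step 𝕜 c) x = ‖step 𝕜 c x‖ₑ := by
  rw [IntervalLattice.extSquareFunction, topDiff_step 𝕜 hc,
    ← (Equiv.addRight (1 : ℤ)).tsum_eq
      (fun k => ‖nestedLattice.genDiff k (step 𝕜 c) x‖ₑ ^ (2 : ℝ))]
  simp only [Equiv.coe_addRight]
  rw [genDiff_step_sum 𝕜 hc hx, enorm_zero, ENNReal.zero_rpow_of_pos two_pos, add_zero,
    ENNReal.rpow_rpow_one_div two_ne_zero]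

end NestedLattice

namespace NestedLattice

variable {i j k l n m : ℕ} {x : ℝ} {I J : Set ℝ} (𝕜 : Type*) [RCLike 𝕜]

/-! ### Norms of step functions -/

theorem volume_core_le (j n : ℕ) : volume (core j n) ≤ 1 := by
  have := offset_nonneg n
  rw [core, Real.volume_Ico, ENNReal.ofReal_le_one]
  linarith

theorem le_volume_core (j n : ℕ) : 2⁻¹ ≤ volume (core j n) := by
  have := offset_lt n
  rw [core, Real.volume_Ico, ← ENNReal.ofReal_ofNat, ← ENNReal.ofReal_inv_of_pos two_pos]
  exact ENNReal.ofReal_le_ofReal (by linarith)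

theorem volume_core_diff (j n : ℕ) :
    volume (core j n \ core j (n + 1)) = ENNReal.ofReal ((4 * 2 ^ n)⁻¹) := by
  have h1 := offset_strictMono n.lt_succ_self
  have h2 : (0 : ℝ) ≤ (1 / 2) ^ n / 8 := by positivity
  rw [core_diff_core, measure_union (disjoint_leftPiece_rightPiece j n)
    (measurableSet_rightPiece j n), leftPiece, rightPiece, Real.volume_Ico, Real.volume_Ico,
    offset_succ, ← ENNReal.ofReal_add (by linarith) (by linarith)]
  congr 1
  rw [one_div, inv_pow, mul_inv]
  ring

variable (c : ℕ → ℕ → ℝ) (p : ℝ)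

theorem lintegral_core_diff_step (j i : ℕ) :
    ∫⁻ x in core j i \ core j (i + 1), ‖step 𝕜 c x‖ₑ ^ p
      = ‖c j i‖ₑ ^ p * volume (core j i \ core j (i + 1)) := by
  rw [← setLIntegral_const]
  refine setLIntegral_congr_fun ((measurableSet_core j i).diff (measurableSet_core j (i + 1)))
    fun x hx => ?_
  rw [enorm_step_of_mem_diff 𝕜 c hx]

theorem lintegral_core_eq_add (g : ℝ → ℝ≥0∞) (j i : ℕ) :
    ∫⁻ x in core j i, g x = (∫⁻ x in core j i \ core j (i + 1), g x)
      + ∫⁻ x in core j (i + 1), g x := by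
  rw [← lintegral_inter_add_sdiff g (core j i) (measurableSet_core j (i + 1)), add_comm,
    inter_eq_right.2 (core_antitone j i.le_succ)]

variable {c p} {N : ℕ → ℕ} (hc : ∀ j, ∀ i ≥ N j, c j i = 0) (hp : 0 < p)

include hc hp

theorem lintegral_core_step (j : ℕ) :
    ∫⁻ x in core j 0, ‖step 𝕜 c x‖ₑ ^ p
      = ∑ i ∈ Finset.range (N j), ‖c j i‖ₑ ^ p * volume (core j i \ core j (i + 1)) := by
  have h : ∀ n, ∫⁻ x in core j 0, ‖step 𝕜 c x‖ₑ ^ p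
      = (∑ i ∈ Finset.range n, ‖c j i‖ₑ ^ p * volume (core j i \ core j (i + 1)))
        + ∫⁻ x in core j n, ‖step 𝕜 c x‖ₑ ^ p := by
    intro n
    induction n with
    | zero => simp
    | succ n ih =>
      rw [ih, lintegral_core_eq_add _ j n, lintegral_core_diff_step, Finset.sum_range_succ,
        add_assoc]
  rw [h (N j), setLIntegral_congr_fun (g := fun _ => 0) (measurableSet_core j (N j))
    fun x hx => by simp [step_eq_zero_of_mem_core 𝕜 hc hx, hp], lintegral_zero, add_zero]

omit hc in
theorem cellAvg_eq_zero {k : ℤ} {g : ℝ → 𝕜} (hx : x ∈ nestedLattice.X)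
    (h : ∀ y ∈ nestedLattice.cell k x, g y = 0) :
    nestedLattice.cellAvg k (fun y => ‖g y‖ₑ ^ p) x = 0 := by
  rw [IntervalLattice.cellAvg, setLIntegral_congr_fun (g := fun _ => 0)
    (IntervalLattice.measurableSet_of_mem_gen (IntervalLattice.cell_mem_gen k hx))
    fun y hy => by simp [h y hy, hp], lintegral_zero, ENNReal.zero_div]

theorem cellAvg_step_of_mem_core (hx : x ∈ core j i) :
    nestedLattice.cellAvg i (fun y => ‖nestedLattice.genDiff (i + 1) (step 𝕜 c) y‖ₑ ^ p) x
      = ‖c j i‖ₑ ^ p * volume (core j i \ core j (i + 1)) / volume (core j i) := by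
  have hcell : nestedLattice.cell i x = core j i :=
    IntervalLattice.cell_eq (core_mem_level j (i : ℤ).toNat) hx
  have h0 : ∫⁻ y in core j (i + 1), ‖nestedLattice.genDiff (i + 1) (step 𝕜 c) y‖ₑ ^ p = 0 := by
    rw [setLIntegral_congr_fun (g := fun _ => 0) (measurableSet_core j (i + 1))
      fun y hy => ?_, lintegral_zero]
    rw [genDiff_step_of_mem_core 𝕜 hc (j := j) (by exact_mod_cast hy)]
    simp [hp]
  rw [IntervalLattice.cellAvg, hcell, lintegral_core_eq_add, h0, add_zero,
    ← lintegral_core_diff_step 𝕜 c p]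
  congr 1
  refine setLIntegral_congr_fun ((measurableSet_core j i).diff (measurableSet_core j (i + 1)))
    fun y hy => ?_
  rw [genDiff_step_of_mem_diff 𝕜 hc hy, if_pos rfl]

theorem cellAvg_step_of_notMem_core (hx : x ∈ core j 0) (hxi : x ∉ core j i) :
    nestedLattice.cellAvg i (fun y => ‖nestedLattice.genDiff (i + 1) (step 𝕜 c) y‖ₑ ^ p) x = 0 := by
  refine cellAvg_eq_zero 𝕜 hp (mem_core_zero_iff.1 hx).1 fun y hy => ?_
  obtain ⟨l, hl, h⟩ := (mem_core_or_mem_diff hx i).resolve_left hxi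
  have hyl : y ∈ core j l \ core j (l + 1) := by
    rw [core_diff_core] at h
    rcases h with h | h
    · rw [IntervalLattice.cell_eq (I := leftPiece j l)
        (leftPiece_mem_level (n := (i : ℤ).toNat) j hl) h] at hy
      exact leftPiece_subset_diff j l hy
    · rw [IntervalLattice.cell_eq (I := rightPiece j l)
        (rightPiece_mem_level (n := (i : ℤ).toNat) j hl) h] at hy
      exact rightPiece_subset_diff j l hy
  rw [genDiff_step_of_mem_diff 𝕜 hc hyl, if_neg (by exact_mod_cast hl.ne')]

theorem cellAvg_step_of_neg {k : ℤ} (hk : k < 0) (hx : x ∈ core j 0) :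
    nestedLattice.cellAvg k (fun y => ‖nestedLattice.genDiff (k + 1) (step 𝕜 c) y‖ₑ ^ p) x = 0 := by
  refine cellAvg_eq_zero 𝕜 hp (mem_core_zero_iff.1 hx).1 fun y hy => ?_
  have hyX : y ∈ nestedLattice.X := IntervalLattice.subset_X_of_mem_gen
    (IntervalLattice.cell_mem_gen k (mem_core_zero_iff.1 hx).1) hy
  refine genDiff_step_of_mem_core 𝕜 hc (j := ⌊y⌋₊) ?_
  rw [Int.toNat_of_nonpos (by omega)]
  exact mem_core_floor_zero hyX

/-- At most `N j` averages are nonzero at `x`. Each is at most `2 * w`, the 2 coming from the lower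
bound 1/2 for the length of a core. -/
theorem avgSquareFunction_step_le {w : ℝ≥0∞} (hx : x ∈ core j 0)
    (hw : ∀ i < N j, ‖c j i‖ₑ ^ p * volume (core j i \ core j (i + 1)) = w) :
    nestedLattice.avgSquareFunction p (step 𝕜 c) x ^ p ≤ (N j : ℝ≥0∞) ^ (p / 2) * (2 * w) := by
  rw [IntervalLattice.avgSquareFunction_eq _ hp (mem_core_zero_iff.1 hx).1,
    tsum_eq_sum (s := (Finset.range (N j)).map Nat.castEmbedding), Finset.sum_map]
  · have h1 : ∀ i ∈ Finset.range (N j), nestedLattice.cellAvg i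
        (fun y => ‖nestedLattice.genDiff (i + 1) (step 𝕜 c) y‖ₑ ^ p) x ^ (2 / p)
        ≤ (2 * w) ^ (2 / p) := by
      intro i hi
      refine ENNReal.rpow_le_rpow ?_ (by positivity)
      by_cases hxi : x ∈ core j i
      · rw [cellAvg_step_of_mem_core 𝕜 hc hp hxi, hw i (Finset.mem_range.1 hi), mul_comm 2 w,
          ENNReal.div_eq_inv_mul, mul_comm]
        gcongr
        rw [ENNReal.inv_le_iff_inv_le]
        exact le_volume_core j i
      · rw [cellAvg_step_of_notMem_core 𝕜 hc hp hx hxi]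
        exact zero_le
    have h2 := Finset.sum_le_card_nsmul _ _ _ h1
    rw [Finset.card_range, nsmul_eq_mul] at h2
    rw [← ENNReal.rpow_mul, one_div_mul_eq_div]
    refine (ENNReal.rpow_le_rpow h2 (by positivity)).trans_eq ?_
    rw [ENNReal.mul_rpow_of_nonneg _ _ (by positivity), ← ENNReal.rpow_mul,
      div_mul_div_cancel₀ hp.ne', div_self two_ne_zero, ENNReal.rpow_one]
  · intro k hk
    have h2p : 0 < 2 / p := by positivity
    rcases lt_or_ge k 0 with hk0 | hk0
    · rw [cellAvg_step_of_neg 𝕜 hc hp hk0 hx, ENNReal.zero_rpow_of_pos h2p]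
    · lift k to ℕ using hk0
      have hkN : N j ≤ k := by simpa using hk
      by_cases hxi : x ∈ core j k
      · rw [cellAvg_step_of_mem_core 𝕜 hc hp hxi, hc j k hkN]
        simp [hp, h2p]
      · rw [cellAvg_step_of_notMem_core 𝕜 hc hp hx hxi, ENNReal.zero_rpow_of_pos h2p]

/-- A point common to all cores sees all `N j` averages, and each is at least `w` since cores have
length at most 1. -/
theorem le_avgSquareFunction_step {w : ℝ≥0∞} (hx : ∀ i, x ∈ core j i)
    (hw : ∀ i < N j, ‖c j i‖ₑ ^ p * volume (core j i \ core j (i + 1)) = w) :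
    (N j : ℝ≥0∞) ^ (p / 2) * w ≤ nestedLattice.avgSquareFunction p (step 𝕜 c) x ^ p := by
  have h1 : ∀ i ∈ Finset.range (N j), w ^ (2 / p) ≤ nestedLattice.cellAvg i
      (fun y => ‖nestedLattice.genDiff (i + 1) (step 𝕜 c) y‖ₑ ^ p) x ^ (2 / p) := by
    intro i hi
    refine ENNReal.rpow_le_rpow ?_ (by positivity)
    rw [cellAvg_step_of_mem_core 𝕜 hc hp (hx i), hw i (Finset.mem_range.1 hi),
      ENNReal.div_eq_inv_mul]
    exact le_mul_of_one_le_left' (ENNReal.one_le_inv.2 (volume_core_le j i))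
  have h2 := (Finset.card_nsmul_le_sum _ _ _ h1).trans
    ((Finset.sum_map (Finset.range (N j)) Nat.castEmbedding fun k : ℤ => nestedLattice.cellAvg k
      (fun y => ‖nestedLattice.genDiff (k + 1) (step 𝕜 c) y‖ₑ ^ p) x ^ (2 / p)).symm.le.trans
    (ENNReal.sum_le_tsum _))
  rw [Finset.card_range, nsmul_eq_mul] at h2
  rw [IntervalLattice.avgSquareFunction_eq _ hp (mem_core_zero_iff.1 (hx 0)).1,
    ← ENNReal.rpow_mul, one_div_mul_eq_div]
  refine le_trans (le_of_eq ?_) (ENNReal.rpow_le_rpow h2 (by positivity))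
  rw [ENNReal.mul_rpow_of_nonneg _ _ (by positivity), ← ENNReal.rpow_mul,
    div_mul_div_cancel₀ hp.ne', div_self two_ne_zero, ENNReal.rpow_one]

theorem memHardy_step (h : ∫⁻ x in nestedLattice.X, ‖step 𝕜 c x‖ₑ ^ p ≠ ∞) :
    nestedLattice.MemHardy p (step 𝕜 c) where
  admissible := admissible_step 𝕜 hc
  integrable hp1 := by
    subst hp1
    refine ⟨(measurable_step_borel 𝕜 c).aestronglyMeasurable, ?_⟩
    simpa only [ENNReal.rpow_one, HasFiniteIntegral, lt_top_iff_ne_top] using h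
  extSquareFunction_lt_top := by
    rw [IntervalLattice.lpNorm_eq hp, setLIntegral_congr_fun IntervalLattice.measurableSet_X
      fun x hx => by rw [extSquareFunction_step 𝕜 hc hx]]
    exact ENNReal.rpow_lt_top_of_nonneg (by positivity) h
  topMeanZero := topMeanZero_step 𝕜 hc

theorem lpNorm_squareFunction_step : nestedLattice.lpNorm p
    (nestedLattice.squareFunction (step 𝕜 c))
      = (∫⁻ x in nestedLattice.X, ‖step 𝕜 c x‖ₑ ^ p) ^ (1 / p) := by
  rw [IntervalLattice.lpNorm_eq hp, setLIntegral_congr_fun IntervalLattice.measurableSet_X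
    fun x hx => by rw [squareFunction_step 𝕜 hc hx]]

end NestedLattice

namespace NestedLattice

variable {i j : ℕ} {x : ℝ}

/-! ### Step functions with `2 ^ j` equally large differences inside `[j, j + 1)` -/

/-- The coefficients for which the first `2 ^ j` martingale differences on `[j, j + 1)` all have
the same `p`-th moment `w j`. -/
noncomputable def coeff (p : ℝ) (w : ℕ → ℝ≥0) (j i : ℕ) : ℝ :=
  -- The factor `4 * 2 ^ i` is the reciprocal of the measure of `core j i \ core j (i + 1)`.
  if i < 2 ^ j then (w j * (4 * 2 ^ i)) ^ (1 / p) else 0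

variable {p : ℝ} (w : ℕ → ℝ≥0)

theorem coeff_eq_zero (p : ℝ) (j i : ℕ) (hi : 2 ^ j ≤ i) : coeff p w j i = 0 :=
  if_neg hi.not_gt

theorem enorm_coeff_rpow_mul (hp : 0 < p) (hi : i < 2 ^ j) :
    ‖coeff p w j i‖ₑ ^ p * volume (core j i \ core j (i + 1)) = w j := by
  have h0 : (0 : ℝ) ≤ w j * (4 * 2 ^ i) := by positivity
  rw [coeff, if_pos hi, ← Real.enorm_rpow_of_nonneg (by positivity) hp.le, ← Real.rpow_mul h0,
    one_div_mul_cancel hp.ne', Real.rpow_one, Real.enorm_of_nonneg h0, volume_core_diff,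
    ← ENNReal.ofReal_mul h0, mul_assoc, mul_inv_cancel₀ (by positivity), mul_one,
    ENNReal.ofReal_coe_nnreal]

variable (𝕜 : Type*) [RCLike 𝕜]

/-- The block $[j,j+1)$ contributes $2^jw_j$ here, to be set against the order $2^{jp/2}w_j$ for the
averaged square function. -/
theorem lintegral_step_coeff (hp : 0 < p) :
    ∫⁻ x in nestedLattice.X, ‖step 𝕜 (coeff p w) x‖ₑ ^ p = ∑' j, 2 ^ j * (w j : ℝ≥0∞) := by
  rw [lintegral_X_eq_tsum_core]
  refine tsum_congr fun j => ?_
  rw [lintegral_core_step 𝕜 (coeff_eq_zero w p) hp, Finset.sum_congr rfl fun i hi =>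
    enorm_coeff_rpow_mul w hp (Finset.mem_range.1 hi)]
  simp

theorem natCast_two_pow_rpow (j : ℕ) (s : ℝ) :
    (((2 ^ j : ℕ) : ℝ≥0∞)) ^ s = ((2 : ℝ≥0∞) ^ s) ^ j := by
  rw [Nat.cast_pow, Nat.cast_ofNat, ← ENNReal.rpow_natCast, ← ENNReal.rpow_natCast,
    ← ENNReal.rpow_mul, ← ENNReal.rpow_mul, mul_comm]

theorem lintegral_avgSquareFunction_step_coeff_le (hp : 0 < p) :
    ∫⁻ x in nestedLattice.X, nestedLattice.avgSquareFunction p (step 𝕜 (coeff p w)) x ^ p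
      ≤ 2 * ∑' j, (2 ^ (p / 2)) ^ j * (w j : ℝ≥0∞) := by
  rw [lintegral_X_eq_tsum_core, ← ENNReal.tsum_mul_left]
  refine ENNReal.tsum_le_tsum fun j => ?_
  calc _ ≤ ∫⁻ x in core j 0, (2 ^ (p / 2)) ^ j * (2 * (w j : ℝ≥0∞)) := by
        refine setLIntegral_mono' (measurableSet_core j 0) fun x hx => ?_
        rw [← natCast_two_pow_rpow]
        exact avgSquareFunction_step_le 𝕜 (coeff_eq_zero w p) hp hx
          fun i hi => enorm_coeff_rpow_mul w hp hi
    _ ≤ (2 ^ (p / 2)) ^ j * (2 * (w j : ℝ≥0∞)) * 1 := by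
        rw [setLIntegral_const]
        gcongr
        exact volume_core_le j 0
    _ = _ := by rw [mul_one, mul_left_comm]

theorem le_lintegral_avgSquareFunction_step_coeff (hp : 0 < p) :
    2⁻¹ * ∑' j, (2 ^ (p / 2)) ^ j * (w j : ℝ≥0∞)
      ≤ ∫⁻ x in nestedLattice.X, nestedLattice.avgSquareFunction p (step 𝕜 (coeff p w)) x ^ p := by
  rw [lintegral_X_eq_tsum_core, ← ENNReal.tsum_mul_left]
  refine ENNReal.tsum_le_tsum fun j => ?_
  -- The middle half lies in every core, because all offsets are below 1/4.
  set M : Set ℝ := Ico (j + 1 / 4) (j + 3 / 4)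
  have hM : ∀ i, M ⊆ core j i := fun i => Ico_subset_Ico (by linarith [offset_lt i])
    (by linarith [offset_lt i])
  have hvol : volume M = 2⁻¹ := by
    rw [Real.volume_Ico, ← ENNReal.ofReal_ofNat, ← ENNReal.ofReal_inv_of_pos two_pos]
    congr 1
    ring
  calc _ = ∫⁻ x in M, (2 ^ (p / 2)) ^ j * (w j : ℝ≥0∞) := by
        rw [setLIntegral_const, hvol, mul_comm]
    _ ≤ ∫⁻ x in M, nestedLattice.avgSquareFunction p (step 𝕜 (coeff p w)) x ^ p := by
        refine setLIntegral_mono' measurableSet_Ico fun x hx => ?_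
        rw [← natCast_two_pow_rpow]
        exact le_avgSquareFunction_step 𝕜 (coeff_eq_zero w p) hp (fun i => hM i hx)
          fun i hi => enorm_coeff_rpow_mul w hp hi
    _ ≤ _ := lintegral_mono_set (hM 0)

/-- For `p > 2` the averaged square function is not controlled by the square function. -/
theorem exists_avgSquareFunction_eq_top (hp : 2 < p) : ∃ (L : IntervalLattice) (f : ℝ → 𝕜),
    L.MemHardy p f ∧ MemLp f (ENNReal.ofReal p) (volume.restrict L.X) ∧
      L.lpNorm p (L.squareFunction f) < ∞ ∧ L.lpNorm p (L.avgSquareFunction p f) = ∞ := by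
  have hp0 : 0 < p := by linarith
  have hp' : (0 : ℝ) < 1 / p := by positivity
  -- With $w_j=2^{-jp/2}$ the blocks contribute the geometric terms $2^{j(1-p/2)}$ to the square
  -- function, but terms bounded below to the averaged one.
  set ρ : ℝ≥0 := 2 ^ (-(p / 2)) with hρ
  have hρ' : (ρ : ℝ≥0∞) = 2 ^ (-(p / 2)) := by
    rw [hρ, ENNReal.coe_rpow_of_ne_zero two_ne_zero, ENNReal.coe_ofNat]
  set w : ℕ → ℝ≥0 := fun j => ρ ^ j with hw
  have hfin : ∫⁻ x in nestedLattice.X, ‖step 𝕜 (coeff p w) x‖ₑ ^ p ≠ ∞ := by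
    rw [lintegral_step_coeff w 𝕜 hp0]
    have : ∀ j, 2 ^ j * (w j : ℝ≥0∞) = (2 ^ (1 - p / 2)) ^ j := fun j => by
      rw [hw, ENNReal.coe_pow, ← mul_pow, hρ', sub_eq_add_neg,
        ENNReal.rpow_add _ _ two_ne_zero ENNReal.ofNat_ne_top, ENNReal.rpow_one]
    rw [tsum_congr this, ENNReal.tsum_geometric, ENNReal.inv_ne_top]
    refine (tsub_pos_of_lt ?_).ne'
    exact ENNReal.rpow_lt_one_of_one_lt_of_neg (by norm_num) (by linarith)
  have htop : ∫⁻ x in nestedLattice.X,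
      nestedLattice.avgSquareFunction p (step 𝕜 (coeff p w)) x ^ p = ∞ := by
    refine top_le_iff.1 ((le_of_eq ?_).trans
      (le_lintegral_avgSquareFunction_step_coeff w 𝕜 hp0))
    have : ∀ j, ((2 : ℝ≥0∞) ^ (p / 2)) ^ j * (w j : ℝ≥0∞) = 1 := fun j => by
      rw [hw, ENNReal.coe_pow, ← mul_pow, hρ', ← ENNReal.rpow_add _ _ two_ne_zero
        ENNReal.ofNat_ne_top, add_neg_cancel, ENNReal.rpow_zero, one_pow]
    rw [tsum_congr this, ENNReal.tsum_const_eq_top_of_ne_zero one_ne_zero,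
      ENNReal.mul_top (by simp)]
  refine ⟨nestedLattice, step 𝕜 (coeff p w), memHardy_step 𝕜 (coeff_eq_zero w p) hp0 hfin,
    ⟨(measurable_step_borel 𝕜 _).aestronglyMeasurable, ?_⟩, ?_, ?_⟩
  · rw [eLpNorm_eq_lintegral_rpow_enorm_toReal (by simpa using hp0) ENNReal.ofReal_ne_top,
      ENNReal.toReal_ofReal hp0.le]
    exact ENNReal.rpow_lt_top_of_nonneg hp'.le hfin
  · rw [lpNorm_squareFunction_step 𝕜 (coeff_eq_zero w p) hp0]
    exact ENNReal.rpow_lt_top_of_nonneg hp'.le hfin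
  · rw [IntervalLattice.lpNorm_eq hp0, htop, ENNReal.top_rpow_of_pos hp']

theorem two_rpow_mul_inv_two_lt_one (hp2 : p < 2) : (2 : ℝ≥0∞) ^ (p / 2) * 2⁻¹ < 1 := by
  rw [← ENNReal.rpow_neg_one, ← ENNReal.rpow_add _ _ two_ne_zero ENNReal.ofNat_ne_top]
  exact ENNReal.rpow_lt_one_of_one_lt_of_neg (by norm_num) (by linarith)

/-- For `p < 2` the square function need not be in `L^p` if the averaged square function is. -/
theorem exists_squareFunction_eq_top (hp0 : 0 < p) (hp2 : p < 2) : ∃ f : ℝ → 𝕜,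
    nestedLattice.Admissible f ∧ nestedLattice.TopMeanZero f ∧
      nestedLattice.lpNorm p (nestedLattice.avgSquareFunction p f) < ∞ ∧
      nestedLattice.lpNorm p (nestedLattice.squareFunction f) = ∞ := by
  have hp' : (0 : ℝ) < 1 / p := by positivity
  -- Each block now contributes 1 to the square function, while the averaged one is bounded by a
  -- geometric series of ratio $2^{p/2-1}<1$.
  set w : ℕ → ℝ≥0 := fun j => 2⁻¹ ^ j with hw
  have hw' : ∀ j, (w j : ℝ≥0∞) = 2⁻¹ ^ j := fun j => by
    rw [hw, ENNReal.coe_pow, ENNReal.coe_inv two_ne_zero, ENNReal.coe_ofNat]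
  refine ⟨step 𝕜 (coeff p w), admissible_step 𝕜 (coeff_eq_zero w p),
    topMeanZero_step 𝕜 (coeff_eq_zero w p), ?_, ?_⟩
  · rw [IntervalLattice.lpNorm_eq hp0]
    refine ENNReal.rpow_lt_top_of_nonneg hp'.le (ne_top_of_le_ne_top ?_
      (lintegral_avgSquareFunction_step_coeff_le w 𝕜 hp0))
    refine ENNReal.mul_ne_top ENNReal.ofNat_ne_top ?_
    simp_rw [hw', ← mul_pow]
    rw [ENNReal.tsum_geometric, ENNReal.inv_ne_top]
    exact (tsub_pos_of_lt (two_rpow_mul_inv_two_lt_one hp2)).ne'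
  · rw [lpNorm_squareFunction_step 𝕜 (coeff_eq_zero w p) hp0, lintegral_step_coeff w 𝕜 hp0]
    simp_rw [hw', ← mul_pow, ENNReal.mul_inv_cancel two_ne_zero ENNReal.ofNat_ne_top, one_pow]
    rw [ENNReal.tsum_const_eq_top_of_ne_zero one_ne_zero, ENNReal.top_rpow_of_pos hp']

/-- For `p < 2` the square function is not controlled by the averaged square function on `H^p`. -/
theorem exists_mul_avgSquareFunction_lt (hp0 : 0 < p) (hp2 : p < 2) (C : ℝ≥0) : ∃ f : ℝ → 𝕜,
    nestedLattice.MemHardy p f ∧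
      C * nestedLattice.lpNorm p (nestedLattice.avgSquareFunction p f)
        < nestedLattice.lpNorm p (nestedLattice.squareFunction f) := by
  have hp' : (0 : ℝ) < 1 / p := by positivity
  have hCt : (C : ℝ≥0∞) ^ p * 2 ≠ ∞ := ENNReal.mul_ne_top
    (ENNReal.rpow_ne_top_of_nonneg hp0.le ENNReal.coe_ne_top) ENNReal.ofNat_ne_top
  obtain ⟨J, hJ⟩ : ∃ J : ℕ, (C : ℝ≥0∞) ^ p * 2 * ((2 : ℝ≥0∞) ^ (p / 2) * 2⁻¹) ^ J < 1 := by
    have h := ENNReal.Tendsto.const_mul (ENNReal.tendsto_pow_atTop_nhds_zero_of_lt_one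
      (two_rpow_mul_inv_two_lt_one hp2)) (Or.inr hCt)
    rw [mul_zero] at h
    exact (h.eventually_lt_const one_pos).exists
  -- A single block keeps the function in $H^p$ with $\|Sf\|_p=1$, and
  -- $\|S_p^{\mathrm{av}}f\|_p^p\le2\cdot2^{J(p/2-1)}$ is as small as desired for large $J$.
  set w : ℕ → ℝ≥0 := fun j => if j = J then 2⁻¹ ^ J else 0 with hw
  have hwJ : (w J : ℝ≥0∞) = 2⁻¹ ^ J := by
    rw [hw]
    simp only [if_true]
    rw [ENNReal.coe_pow, ENNReal.coe_inv two_ne_zero, ENNReal.coe_ofNat]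
  have hsum : ∀ g : ℕ → ℝ≥0∞, ∑' j, g j * (w j : ℝ≥0∞) = g J * 2⁻¹ ^ J := fun g => by
    rw [tsum_eq_single J fun j hj => by simp [hw, hj], hwJ]
  have hone : ∫⁻ x in nestedLattice.X, ‖step 𝕜 (coeff p w) x‖ₑ ^ p = 1 := by
    rw [lintegral_step_coeff w 𝕜 hp0, hsum, ← mul_pow,
      ENNReal.mul_inv_cancel two_ne_zero ENNReal.ofNat_ne_top, one_pow]
  refine ⟨step 𝕜 (coeff p w), memHardy_step 𝕜 (coeff_eq_zero w p) hp0
    (hone ▸ ENNReal.one_ne_top), ?_⟩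
  rw [lpNorm_squareFunction_step 𝕜 (coeff_eq_zero w p) hp0, hone, ENNReal.one_rpow,
    IntervalLattice.lpNorm_eq hp0]
  have h := lintegral_avgSquareFunction_step_coeff_le w 𝕜 hp0
  rw [hsum, ← mul_pow] at h
  calc _ ≤ (C : ℝ≥0∞) * (2 * ((2 : ℝ≥0∞) ^ (p / 2) * 2⁻¹) ^ J) ^ (1 / p) := by gcongr
    _ = ((C : ℝ≥0∞) ^ p * 2 * ((2 : ℝ≥0∞) ^ (p / 2) * 2⁻¹) ^ J) ^ (1 / p) := by
        rw [mul_assoc ((C : ℝ≥0∞) ^ p), ENNReal.mul_rpow_of_nonneg ((C : ℝ≥0∞) ^ p) _ hp'.le,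
          ENNReal.rpow_rpow_one_div hp0.ne']
    _ < 1 := ENNReal.rpow_lt_one hJ hp'

end NestedLattice

theorem mainTheorem3 (𝕜 : Type*) [RCLike 𝕜] :
    (∀ p : ℝ, 1 ≤ p → p ≤ 2 → ∃ C : ℝ≥0, ∀ (L : IntervalLattice) (f : ℝ → 𝕜), L.MemHardy p f →
      L.lpNorm p (L.avgSquareFunction p f) ≤ C * L.lpNorm p (L.squareFunction f)) ∧
    (∀ p : ℝ, 2 ≤ p → ∃ C : ℝ≥0, ∀ (L : IntervalLattice) (f : ℝ → 𝕜), L.MemHardy p f →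
      L.lpNorm p (L.squareFunction f) ≤ C * L.lpNorm p (L.avgSquareFunction p f)) ∧
    (∀ p : ℝ, 2 < p → ∃ (L : IntervalLattice) (f : ℝ → 𝕜), L.MemHardy p f ∧
      MemLp f (ENNReal.ofReal p) (volume.restrict L.X) ∧
      L.lpNorm p (L.squareFunction f) < ∞ ∧
      L.lpNorm p (L.avgSquareFunction p f) = ∞) ∧
    (∀ p : ℝ, 1 ≤ p → p < 2 → ∃ L : IntervalLattice,
      (∃ f : ℝ → 𝕜, L.Admissible f ∧ L.TopMeanZero f ∧
        L.lpNorm p (L.avgSquareFunction p f) < ∞ ∧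
        L.lpNorm p (L.squareFunction f) = ∞) ∧
      (∀ C : ℝ≥0, ∃ f : ℝ → 𝕜, L.MemHardy p f ∧
        C * L.lpNorm p (L.avgSquareFunction p f) < L.lpNorm p (L.squareFunction f))) := by
  refine ⟨fun p hp1 hp2 => ?_, fun p hp => IntervalLattice.exists_lpNorm_squareFunction_le 𝕜 hp,
    fun p hp => NestedLattice.exists_avgSquareFunction_eq_top 𝕜 hp, fun p hp1 hp2 => ?_⟩
  · obtain ⟨C, hC⟩ := IntervalLattice.exists_lpNorm_avgSquareFunction_le 𝕜 hp1 hp2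
    exact ⟨C, fun L f _ => hC L f⟩
  · have hp0 : 0 < p := by linarith
    exact ⟨nestedLattice, NestedLattice.exists_squareFunction_eq_top 𝕜 hp0 hp2,
      NestedLattice.exists_mul_avgSquareFunction_lt 𝕜 hp0 hp2⟩
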